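/- Notation. Put $\mathbf e(z)=e^{2\pi i z}$ and $(p)_k=p(p+1)\cdots(p+k-1)$. For complex $c,d,e$ with $d,e\notin\{0,-1,-2,\dots\}$ and $\operatorname{Re}(d+e-c-2)>0$, let $$F(1,1,c;d,e;1)=\sum_{k\ge 0}\frac{(1)_k(1)_k(c)_k}{(d)_k(e)_k\,k!}.$$ For all $(c,d,e)\in\mathbb C^3$ such that none of $d$, $e$, $d+e-c-2$ lies in $\{0,-1,-2,\dots\}$, the symbol $F(1,1,c;d,e;1)$ denotes the value of the holomorphic continuation of this function in the parameters $(c,d,e)$ (part of the claim is that this continuation exists). Let $f$ be a rational function and $0<\varepsilon<1$ such that $f$ has no pole on $[0,1]$ or in the disc $|x|\le\varepsilon$. For real $a\notin\mathbb Z$ let $$\int_{P(0,1)}x^af(x)\,dx=\int_\varepsilon^1x^af(x)\,dx+\frac1{\mathbf e(a)-1}\int_{C_\varepsilon}x^af(x)\,dx,$$ where $C_\varepsilon$ is the circle $t\mapsto\varepsilon\,\mathbf e(t)$, $0\le t\le1$, and $x^a=\varepsilon^a\mathbf e(at)$ at the point $\varepsilon\,\mathbf e(t)$ of $C_\varepsilon$.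 For $a\in\mathbb Z$, $\int_{P(0,1)}x^af(x)\,dx$ denotes the limit of $\int_{P(0,1)}x^{a'}f(x)\,dx$ as $a'\to a$ through real $a'\notin\mathbb Z$, when it exists (for integers $a\ge0$ it is $\int_0^1x^af(x)\,dx$). The integral of a sum of such terms is the sum of their integrals. Theorem. Let $\alpha,\beta$ be real numbers. For every $\varepsilon\in(0,1)$ the following identities hold (all limits in the definition of the integrals on the right exist). 1. If $\alpha\notin\mathbb Z$ and none of $\beta$, $\beta-\alpha$, $\beta+\alpha$ is a negative integer, then $$\frac{\alpha}{(\beta-\alpha+1)(\beta+1+\alpha)}F(1,1,\beta+1;\beta-\alpha+2,\beta+2+\alpha;1)=\int_{P(0,1)}\frac{x^{\beta-\alpha}-x^{\beta+\alpha}}{1+x}\,dx.$$ 2. If $2\alpha\notin\mathbb Z$, then $$\frac1{\alpha+1/2}F(1,1,\tfrac12;\alpha+1,\alpha+\tfrac32;1)=2\int_{P(0,1)}\frac{x^{2\alpha-1}}{2-x}\,dx.$$ 3. If $3\alpha\notin\mathbb Z$ and $2\alpha+\frac13,\ 2\alpha+\frac23\notin\{0,-1,-2,\dots\}$, then $$\frac{\alpha}{(6\alpha+1)(2\alpha+2/3)}F(1,1,\alpha+1;2\alpha+\tfrac43,2\alpha+\tfrac53;1)=\int_{P(0,1)}y^{6\alpha+1}\frac{3+y^3}{27+y^6}\,dy+\int_{P(0,1)}x^{6\alpha}\frac{9+x^3}{27+x^6}\,dx.$$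 4. If $4\alpha\notin\mathbb Z$ and $3\alpha+\frac14,\ 3\alpha+\frac34\notin\{0,-1,-2,\dots\}$, then $$\frac{4\alpha}{(12\alpha+1)(3\alpha+3/4)}F(1,1,2\alpha+1;3\alpha+\tfrac54,3\alpha+\tfrac74;1)=\int_{P(0,1)}y^{12\alpha}\frac{2y^2(8-4y^4-y^8)}{64-y^{12}}\,dy+\int_{P(0,1)}x^{12\alpha}\frac{2(8x^4+32-x^8)}{64-x^{12}}\,dx.$$ -/

import Mathlib

open Filter Topology

noncomputable section

/-- The hypergeometric series `₃F₂(p₁, p₂, p₃; p₄, p₅; x) = ∑ₖ (p₁)ₖ (p₂)ₖ (p₃)ₖ / ((p₄)ₖ (p₅)ₖ k!) xᵏ`,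
where `(p)ₖ = p (p + 1) ⋯ (p + k - 1)`. -/
def hyp3F2 (p₁ p₂ p₃ p₄ p₅ x : ℂ) : ℂ :=
  ∑' k : ℕ, ((ascPochhammer ℂ k).eval p₁ * (ascPochhammer ℂ k).eval p₂ *
      (ascPochhammer ℂ k).eval p₃) /
    ((ascPochhammer ℂ k).eval p₄ * (ascPochhammer ℂ k).eval p₅ * (k.factorial : ℂ)) * x ^ k

/-- The parameters `(c, d, e)` such that none of the lower parameters `d`, `e` of
`₃F₂(1, 1, c; d, e; 1)` and of the parametric excess `s = d + e - c - 2` is one of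
`0, -1, -2, …`. This is a connected open subset of `ℂ³`. -/
def hypDomain : Set (ℂ × ℂ × ℂ) :=
  {p | ∀ n : ℕ, p.2.1 ≠ -(n : ℂ) ∧ p.2.2 ≠ -(n : ℂ) ∧ p.2.1 + p.2.2 - p.1 - 2 ≠ -(n : ℂ)}

/-- `Φ` is a holomorphic continuation, to the whole of `hypDomain`, of the special value
`(c, d, e) ↦ ₃F₂(1, 1, c; d, e; 1)`. The latter is given by the series when the parametric
excess has positive real part, which is where the series at `x = 1` converges absolutely. -/
def IsHypContinuation (Φ : ℂ × ℂ × ℂ → ℂ) : Prop :=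
  DifferentiableOn ℂ Φ hypDomain ∧
    ∀ c d e : ℂ, (c, d, e) ∈ hypDomain → 0 < (d + e - c - 2).re →
      Φ (c, d, e) = hyp3F2 1 1 c d e 1

open Classical in
/-- The special value `₃F₂(1, 1, c; d, e; 1)`, for `(c, d, e)` in `hypDomain`, by analytic
continuation in the parameters. (By the identity theorem there is at most one continuation on
the connected open set `hypDomain`. The value is meaningless if there is none, and outside of
`hypDomain`.) -/
def hyp3F2AtOne (c d e : ℂ) : ℂ :=
  if h : ∃ Φ : ℂ × ℂ × ℂ → ℂ, IsHypContinuation Φ then h.choose (c, d, e) else 0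

/-- `𝐞(z) = exp(2πiz)`. -/
def expTwoPiI (z : ℂ) : ℂ := Complex.exp (2 * (Real.pi : ℂ) * Complex.I * z)

/-- The Pochhammer integral of `x ^ a * f x` over `P(0,1)` for a non-integral exponent `a`:
`∫_ε^1 x^a f(x) dx + (𝐞(a) - 1)⁻¹ ∫_{C_ε} x^a f(x) dx`, where `C_ε` is the circle `t ↦ ε 𝐞(t)`,
`0 ≤ t ≤ 1`, and where `x^a = ε^a 𝐞(at)` at the point `ε 𝐞(t)` of `C_ε`. -/
def pochhammerFormula (ε a : ℝ) (f : ℂ → ℂ) : ℂ :=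
  (∫ x in ε..1, ((x ^ a : ℝ) : ℂ) * f (x : ℂ)) +
    1 / (expTwoPiI a - 1) *
      ∫ t in (0 : ℝ)..1, (((ε ^ a : ℝ) : ℂ) * expTwoPiI ((a * t : ℝ) : ℂ)) *
        f ((ε : ℂ) * expTwoPiI (t : ℂ)) *
        (2 * (Real.pi : ℂ) * Complex.I * (ε : ℂ) * expTwoPiI (t : ℂ))

open Classical in
/-- The Pochhammer integral `∫_{P(0,1)} x ^ a * f x dx`. At an integral exponent `a` it is the
limit of the Pochhammer integrals with non-integral exponents `a' → a` (which is the ordinary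
integral over `[0, 1]` when `0 ≤ a`). -/
def pochhammerIntegral (ε a : ℝ) (f : ℂ → ℂ) : ℂ :=
  if ∃ n : ℤ, a = n then limUnder (𝓝[≠] a) (fun a' : ℝ => pochhammerFormula ε a' f)
  else pochhammerFormula ε a f

end

/-! Both sides of each identity are the same series `∑ κⁿ g(w + r n)`, with `g` a finite sum of
simple fractions (`lerchSum`, `monomialMellin`).

On the integral side, each rational function satisfies `f(z) = ∑ cᵢ z ^ mᵢ + κ z ^ r f(z)`.
Pochhammer integrals are linear, turn `z ^ r` into a shift of the exponent by `r`, and send the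
constant `1` to `1 / (a + 1)`. So the integral satisfies a first-order difference equation in `a`.
Its solution is found by iteration, since the integral tends to zero as `a` grows
(`pochhammerFormula_eq_lerchSum`). At an integral exponent the limit exists because the series is
continuous away from its poles (`pochhammerIntegral_eq_lerchSum`).

On the hypergeometric side, let `V` be the left hand side of an identity, as a function of its
varying parameter (`β` in the first family, `α` in the others). A contiguous relation connects `V`
at two arguments differing by `1` or `1/2`. It is proved for large real parameters by exhibiting a
telescoping certificate for the summands (`alternating_contiguous` and its three analogues). One or
two applications give `V(x) = h(x) + κ V(x + δ)`, matching the equation of the integral. Since `V(x)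
= O(1 / x)`, iteration again leads to the series (`eq_of_hasSum_of_recurrence`).

It remains to leave the region of large real parameters. The value of `₃F₂` continues
holomorphically because a contiguous relation in `d` expresses it through parameters of larger
excess (`tsum_hypTerm_recurrence`, `exists_isHypContinuation`). Along each family the excluded
parameters form a countable set with connected open complement, so the identity theorem applies
(`eqOn_of_eq_of_ofReal_ge`). -/

/-! ### Series of holomorphic functions on a complex normed space -/

/-- The Weierstrass `M`-test for holomorphic functions on a complex normed space. -/
theorem differentiableAt_tsum_of_eventually_norm_le {E : Type*} [NormedAddCommGroup E]
    [NormedSpace ℂ E] {f : ℕ → E → ℂ} {u : ℕ → ℝ} {p₀ : E} (hu : Summable u)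
    (hf : ∀ᶠ p in 𝓝 p₀, ∀ k, DifferentiableAt ℂ (f k) p)
    (hfu : ∀ᶠ p in 𝓝 p₀, ∀ k, ‖f k p‖ ≤ u k) :
    DifferentiableAt ℂ (fun p => ∑' k, f k p) p₀ := by
  obtain ⟨r, hr, hball⟩ := Metric.eventually_nhds_iff_ball.1 (hf.and hfu)
  have hr2 : 0 < r / 2 := by positivity
  let _ : NormedSpace ℝ E := NormedSpace.restrictScalars ℝ ℂ E
  have hsub : ∀ p ∈ Metric.ball p₀ (r / 2), Metric.ball p (r / 2) ⊆ Metric.ball p₀ r := by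
    intro p hp q hq
    rw [Metric.mem_ball] at hp hq ⊢
    linarith [dist_triangle q p p₀]
  have hmem : p₀ ∈ Metric.ball p₀ (r / 2) := Metric.mem_ball_self hr2
  have hbig : Metric.ball p₀ (r / 2) ⊆ Metric.ball p₀ r := Metric.ball_subset_ball (by linarith)
  -- Termwise differentiation needs a summable bound for the derivatives. On a ball of radius `r /
  -- 2` the function `f k` moves by at most `2 * u k`, so the Cauchy estimate gives `2 * u k / (r /
  -- 2)`.
  refine (hasFDerivAt_tsum_of_isPreconnected (𝕜 := ℂ) (f' := fun k p => fderiv ℂ (f k) p)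
    (u := fun k => 2 * u k / (r / 2)) (s := Metric.ball p₀ (r / 2)) (x₀ := p₀)
    ((hu.mul_left 2).div_const _) Metric.isOpen_ball (convex_ball p₀ (r / 2)).isPreconnected
    (fun k p hp => ((hball p (hbig hp)).1 k).hasFDerivAt) ?_ hmem
    (Summable.of_norm_bounded hu (hball p₀ (hbig hmem)).2) hmem).differentiableAt
  intro k p hp
  refine Complex.norm_fderiv_le_div_of_mapsTo_ball (fun q hq =>
    ((hball q (hsub p hp hq)).1 k).differentiableWithinAt) (fun q hq => ?_) hr2
  rw [Metric.mem_closedBall, dist_eq_norm]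
  have h1 := (hball q (hsub p hp hq)).2 k
  have h2 := (hball p (hbig hp)).2 k
  linarith [norm_sub_le (f k q) (f k p)]

/-! ### The domain of the parameters -/

/-- The points `0, -1, -2, …` are the zeros of the entire function `1 / Γ`. -/
theorem isOpen_forall_ne_neg_natCast : IsOpen {w : ℂ | ∀ n : ℕ, w ≠ -(n : ℂ)} := by
  have h : {w : ℂ | ∀ n : ℕ, w ≠ -(n : ℂ)} = (fun w => (Complex.Gamma w)⁻¹) ⁻¹' {0}ᶜ := by
    ext w
    simp [Complex.Gamma_eq_zero_iff]
  rw [h]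
  exact isOpen_compl_singleton.preimage Complex.differentiable_one_div_Gamma.continuous

theorem isOpen_hypDomain : IsOpen hypDomain := by
  have h : hypDomain = (fun p : ℂ × ℂ × ℂ => p.2.1) ⁻¹' {w : ℂ | ∀ n : ℕ, w ≠ -(n : ℂ)} ∩
      ((fun p : ℂ × ℂ × ℂ => p.2.2) ⁻¹' {w : ℂ | ∀ n : ℕ, w ≠ -(n : ℂ)} ∩
      (fun p : ℂ × ℂ × ℂ => p.2.1 + p.2.2 - p.1 - 2) ⁻¹' {w : ℂ | ∀ n : ℕ, w ≠ -(n : ℂ)}) := by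
    ext p
    simp only [hypDomain, Set.mem_ofPred_eq, Set.mem_inter_iff, Set.mem_preimage, forall_and]
  rw [h]
  refine (isOpen_forall_ne_neg_natCast.preimage (by fun_prop)).inter
    ((isOpen_forall_ne_neg_natCast.preimage (by fun_prop)).inter
      (isOpen_forall_ne_neg_natCast.preimage (by fun_prop)))

theorem shift_mem_hypDomain {c d e : ℂ} (h : (c, d, e) ∈ hypDomain) :
    (c, d + 1, e) ∈ hypDomain := by
  intro n
  obtain ⟨h1, -, h3⟩ := h (n + 1)
  obtain ⟨-, h2, -⟩ := h n
  simp only [Nat.cast_add, Nat.cast_one] at h1 h2 h3 ⊢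
  refine ⟨fun H => h1 ?_, h2, fun H => h3 ?_⟩
  · linear_combination H
  · linear_combination H

theorem ascPochhammer_eval_ne_zero {w : ℂ} (hw : ∀ n : ℕ, w ≠ -(n : ℂ)) (k : ℕ) :
    (ascPochhammer ℂ k).eval w ≠ 0 := by
  rw [Ne, ascPochhammer_eval_eq_zero_iff]
  rintro ⟨n, -, h⟩
  exact hw n (by rw [h, neg_neg])

/-! ### The terms of the hypergeometric series at one -/

/-- The terms `(1)ₖ (c)ₖ / ((d)ₖ (e)ₖ)` of the series `₃F₂(1, 1, c; d, e; 1)`. -/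
noncomputable def hypTerm (k : ℕ) (p : ℂ × ℂ × ℂ) : ℂ :=
  (k.factorial : ℂ) * (ascPochhammer ℂ k).eval p.1 /
    ((ascPochhammer ℂ k).eval p.2.1 * (ascPochhammer ℂ k).eval p.2.2)

theorem hyp3F2_one_eq_tsum (c d e : ℂ) : hyp3F2 1 1 c d e 1 = ∑' k, hypTerm k (c, d, e) := by
  refine tsum_congr fun k => ?_
  have hk : (k.factorial : ℂ) ≠ 0 := Nat.cast_ne_zero.2 k.factorial_ne_zero
  simp only [hypTerm, ascPochhammer_eval_one, one_pow, mul_one]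
  rw [mul_assoc (k.factorial : ℂ), mul_comm _ (k.factorial : ℂ), mul_div_mul_left _ _ hk]

theorem hypTerm_succ (k : ℕ) (c d e : ℂ) : hypTerm (k + 1) (c, d, e) =
    hypTerm k (c, d, e) * (((k + 1) * (c + k)) / ((d + k) * (e + k))) := by
  simp only [hypTerm, ascPochhammer_succ_eval, Nat.factorial_succ, Nat.cast_mul, Nat.cast_add,
    Nat.cast_one, div_mul_div_comm]
  congr 1 <;> ring

theorem hypTerm_swap (k : ℕ) (c d e : ℂ) : hypTerm k (c, d, e) = hypTerm k (c, e, d) := by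
  simp only [hypTerm, mul_comm]

theorem ascPochhammer_eval_add_one_mul (k : ℕ) (w : ℂ) :
    (ascPochhammer ℂ k).eval (w + 1) * w = (ascPochhammer ℂ k).eval w * (w + k) := by
  induction k with
  | zero => simp
  | succ k ih =>
    rw [ascPochhammer_succ_eval, ascPochhammer_succ_eval]
    push_cast
    linear_combination (w + 1 + k) * ih

theorem hypTerm_add_one_fst (k : ℕ) {c : ℂ} (d e : ℂ) (hc : c ≠ 0) :
    hypTerm k (c + 1, d, e) = hypTerm k (c, d, e) * ((c + k) / c) := by
  have h := ascPochhammer_eval_add_one_mul k c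
  simp only [hypTerm]
  rw [eq_div_of_mul_eq hc h]
  ring

theorem hypTerm_add_one_snd (k : ℕ) (c : ℂ) {d : ℂ} (e : ℂ) (hd : ∀ n : ℕ, d + n ≠ 0) :
    hypTerm k (c, d + 1, e) = hypTerm k (c, d, e) * (d / (d + k)) := by
  have hd0 : d ≠ 0 := by simpa using hd 0
  have h := ascPochhammer_eval_add_one_mul k d
  simp only [hypTerm]
  rw [eq_div_of_mul_eq hd0 h]
  simp only [div_eq_mul_inv, mul_inv, inv_inv]
  ring

theorem hypTerm_add_one_trd (k : ℕ) (c d : ℂ) {e : ℂ} (he : ∀ n : ℕ, e + n ≠ 0) :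
    hypTerm k (c, d, e + 1) = hypTerm k (c, d, e) * (e / (e + k)) := by
  rw [hypTerm_swap, hypTerm_add_one_snd k c d he, hypTerm_swap]

theorem differentiableAt_hypTerm {p : ℂ × ℂ × ℂ} (hp : p ∈ hypDomain) (k : ℕ) :
    DifferentiableAt ℂ (hypTerm k) p := by
  unfold hypTerm
  have h : ∀ w : ℂ, DifferentiableAt ℂ (fun w => (ascPochhammer ℂ k).eval w) w :=
    fun w => (ascPochhammer ℂ k).differentiable w
  have h1 : DifferentiableAt ℂ (fun p : ℂ × ℂ × ℂ =>
      (k.factorial : ℂ) * (ascPochhammer ℂ k).eval p.1) p :=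
    ((h p.1).comp p differentiableAt_fst).const_mul _
  have h2 : DifferentiableAt ℂ (fun p : ℂ × ℂ × ℂ =>
      (ascPochhammer ℂ k).eval p.2.1 * (ascPochhammer ℂ k).eval p.2.2) p :=
    ((h p.2.1).comp p differentiableAt_snd.fst).mul ((h p.2.2).comp p differentiableAt_snd.snd)
  have h3 := h2.fun_inv (mul_ne_zero (ascPochhammer_eval_ne_zero (fun n => (hp n).1) k)
    (ascPochhammer_eval_ne_zero (fun n => (hp n).2.1) k))
  simpa only [div_eq_mul_inv] using h1.fun_mul h3

/-- The terms satisfy Raabe's criterion, locally uniformly in the parameters. -/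
theorem eventually_norm_ratio_le {p₀ : ℂ × ℂ × ℂ} {σ : ℝ}
    (hσ : σ < (p₀.2.1 + p₀.2.2 - p₀.1 - 2).re) :
    ∀ᶠ q : ℕ × (ℂ × ℂ × ℂ) in atTop ×ˢ 𝓝 p₀,
      ‖((q.1 + 1) * (q.2.1 + q.1)) / ((q.2.2.1 + q.1) * (q.2.2.2 + q.1))‖ ≤
        1 - (1 + σ) / ((q.1 : ℝ) + 1) := by
  -- With `x = 1 / n`, one has `(n - σ)² = n²(1 + x S)`, `|w + n|² = n²(1 + x B)` and `(n + 1)⁴ =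
  -- n⁴(1 + x Q)`. The difference of the squares of the two sides, cleared of denominators, is then
  -- `n⁵ H(x, p)`. Since `H(0, p₀) = 2 (Re s - σ) > 0`, where `s` is the excess at `p₀`, continuity
  -- of `H` settles all large `n` and all `p` near `p₀` at once.
  let S : ℝ → ℝ := fun x => -2 * σ + σ ^ 2 * x
  let B : ℝ → ℂ → ℝ := fun x w => 2 * w.re + x * (w.re ^ 2 + w.im ^ 2)
  let Q : ℝ → ℝ := fun x => 4 + 6 * x + 4 * x ^ 2 + x ^ 3
  let H : ℝ × (ℂ × ℂ × ℂ) → ℝ := fun y =>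
    S y.1 + B y.1 y.2.2.1 + B y.1 y.2.2.2 - Q y.1 - B y.1 y.2.1 +
      y.1 * (S y.1 * B y.1 y.2.2.1 + S y.1 * B y.1 y.2.2.2 + B y.1 y.2.2.1 * B y.1 y.2.2.2 -
        Q y.1 * B y.1 y.2.1) + y.1 ^ 2 * (S y.1 * B y.1 y.2.2.1 * B y.1 y.2.2.2)
  have hH : Continuous H := by
    simp only [H, S, B, Q]
    fun_prop
  have hH0 : 0 < H (0, p₀) := by
    simp only [Complex.add_re, Complex.sub_re, Complex.re_ofNat] at hσ
    simp only [H, S, B, Q]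
    linarith
  have htend : Tendsto (fun q : ℕ × (ℂ × ℂ × ℂ) => ((1 / (q.1 : ℝ)), q.2)) (atTop ×ˢ 𝓝 p₀)
      (𝓝 ((0 : ℝ), p₀)) := by
    rw [nhds_prod_eq (X := ℝ)]
    exact ((tendsto_one_div_atTop_nhds_zero_nat (𝕜 := ℝ)).comp tendsto_fst).prodMk tendsto_snd
  have hpos : ∀ᶠ y in 𝓝 ((0 : ℝ), p₀), 0 < H y := hH.continuousAt.eventually_const_lt hH0
  have hB : ∀ f : ℝ × (ℂ × ℂ × ℂ) → ℂ, Continuous f →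
      ∀ᶠ y in 𝓝 ((0 : ℝ), p₀), 0 < 1 + y.1 * B y.1 (f y) := by
    intro f hf
    have : Continuous fun y : ℝ × (ℂ × ℂ × ℂ) => 1 + y.1 * B y.1 (f y) := by
      simp only [B]
      fun_prop
    exact this.continuousAt.eventually_const_lt (by simp)
  have hS : ∀ᶠ n : ℕ in atTop, σ < n ∧ 0 < n :=
    (tendsto_natCast_atTop_atTop.eventually_gt_atTop σ).and (eventually_gt_atTop 0)
  filter_upwards [htend.eventually hpos, htend.eventually (hB (fun y => y.2.2.1) (by fun_prop)),
    htend.eventually (hB (fun y => y.2.2.2) (by fun_prop)), tendsto_fst.eventually hS]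
    with ⟨n, c, d, e⟩ h1 h2 h3 ⟨h4, h5⟩
  have hn : (0 : ℝ) < n := Nat.cast_pos.2 h5
  have hnorm : ∀ w : ℂ, ‖w + n‖ ^ 2 = (n : ℝ) ^ 2 * (1 + 1 / n * B (1 / n) w) := by
    intro w
    rw [← Complex.normSq_eq_norm_sq, Complex.normSq_apply]
    simp only [B, Complex.add_re, Complex.add_im, Complex.natCast_re, Complex.natCast_im]
    field_simp
    ring
  simp only at h1 h2 h3
  have hd : 0 < ‖d + n‖ ^ 2 := by rw [hnorm]; exact mul_pos (by positivity) h2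
  have he : 0 < ‖e + n‖ ^ 2 := by rw [hnorm]; exact mul_pos (by positivity) h3
  have hd' : 0 < ‖d + n‖ := norm_pos_iff.2 (by rintro h; simp [h] at hd)
  have he' : 0 < ‖e + n‖ := norm_pos_iff.2 (by rintro h; simp [h] at he)
  have hn1 : ‖(n : ℂ) + 1‖ = n + 1 := by
    rw [← Nat.cast_add_one, Complex.norm_natCast]; push_cast; ring
  have hrw : 1 - (1 + σ) / ((n : ℝ) + 1) = (n - σ) / (n + 1) := by
    field_simp
    ring
  simp only [norm_div, norm_mul, hn1]
  rw [hrw, div_le_div_iff₀ (by positivity) (by positivity)]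
  refine le_of_sq_le_sq ?_ (mul_nonneg (by linarith) (by positivity))
  have key : ((n - σ) * (‖d + n‖ * ‖e + n‖)) ^ 2 - ((n + 1) * ‖c + n‖ * (n + 1)) ^ 2 =
      (n : ℝ) ^ 5 * H (1 / n, c, d, e) := by
    have : ((n - σ) * (‖d + n‖ * ‖e + n‖)) ^ 2 - ((n + 1) * ‖c + n‖ * (n + 1)) ^ 2 =
      (n - σ) ^ 2 * ‖d + n‖ ^ 2 * ‖e + n‖ ^ 2 - (n + 1) ^ 4 * ‖c + n‖ ^ 2 := by ring
    rw [this, hnorm, hnorm, hnorm]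
    simp only [H, S, Q]
    field_simp
    ring
  have : 0 < (n : ℝ) ^ 5 * H (1 / n, c, d, e) := mul_pos (by positivity) h1
  linarith

/-- A bound for the terms of the series which is uniform near a given point. -/
theorem exists_eventually_norm_hypTerm_le {p₀ : ℂ × ℂ × ℂ} (hp₀ : p₀ ∈ hypDomain)
    (hs : 0 < (p₀.2.1 + p₀.2.2 - p₀.1 - 2).re) :
    ∃ σ : ℝ, 0 < σ ∧ ∃ C : ℝ, ∀ᶠ p in 𝓝 p₀, ∀ k : ℕ,
      ‖hypTerm k p‖ ≤ C * (((k : ℝ) + 1) ^ (1 + σ))⁻¹ := by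
  obtain ⟨σ, hσ0, hσ⟩ := exists_between hs
  refine ⟨σ, hσ0, ?_⟩
  obtain ⟨P, hP, Q, hQ, hPQ⟩ := eventually_prod_iff.1 (eventually_norm_ratio_le hσ)
  obtain ⟨K, hK⟩ := eventually_atTop.1 hP
  have hnear : ∀ᶠ p in 𝓝 p₀, ∀ k ∈ Finset.range (K + 1),
      ‖hypTerm k p‖ < ‖hypTerm k p₀‖ + 1 := by
    rw [Finset.eventually_all]
    intro k _
    exact (differentiableAt_hypTerm hp₀ k).continuousAt.norm.eventually_lt_const (by linarith)
  have hpow : ∀ k : ℕ, 0 < ((k : ℝ) + 1) ^ (1 + σ) := fun k => by positivity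
  -- This constant dominates the weighted terms with `k ≤ K`. From `K` on, the ratio bound makes
  -- `‖hypTerm k p‖ (k + 1) ^ (1 + σ)` nonincreasing.
  refine ⟨∑ k ∈ Finset.range (K + 1), (‖hypTerm k p₀‖ + 1) * ((k : ℝ) + 1) ^ (1 + σ), ?_⟩
  filter_upwards [hnear, hQ] with p h1 h2 k
  rw [← div_eq_mul_inv, le_div_iff₀ (hpow k)]
  have hsmall : ∀ k ∈ Finset.range (K + 1), ‖hypTerm k p‖ * ((k : ℝ) + 1) ^ (1 + σ) ≤
      ∑ k ∈ Finset.range (K + 1), (‖hypTerm k p₀‖ + 1) * ((k : ℝ) + 1) ^ (1 + σ) := by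
    intro k hk
    refine le_trans (mul_le_mul_of_nonneg_right (h1 k hk).le (hpow k).le) ?_
    exact Finset.single_le_sum (f := fun k : ℕ => (‖hypTerm k p₀‖ + 1) * ((k : ℝ) + 1) ^ (1 + σ))
      (fun i _ => mul_nonneg (by positivity) (hpow i).le) hk
  rcases le_total k K with hk | hk
  · exact hsmall k (Finset.mem_range.2 (by omega))
  · induction k, hk using Nat.le_induction with
    | base => exact hsmall K (Finset.mem_range.2 (by omega))
    | succ k hk ih =>
      refine le_trans ?_ ih
      obtain ⟨c, d, e⟩ := p
      have hr := hPQ (hK k hk) h2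
      simp only at hr
      rw [hypTerm_succ, norm_mul, mul_assoc]
      refine mul_le_mul_of_nonneg_left ?_ (norm_nonneg _)
      have hx : (0 : ℝ) < (k : ℝ) + 1 + 1 := by positivity
      -- Bernoulli's inequality compares the Raabe bound with the ratio `((k + 1) / (k + 2)) ^ (1 +
      -- σ)` of consecutive weights.
      have hB := one_add_mul_self_le_rpow_one_add (s := -(1 / ((k : ℝ) + 1 + 1))) (p := 1 + σ)
        (by
          rw [neg_le_neg_iff, div_le_one hx]
          have : (0 : ℝ) ≤ k := k.cast_nonneg
          linarith) (by linarith)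
      have hle : 1 - (1 + σ) / ((k : ℝ) + 1) ≤ (1 + -(1 / ((k : ℝ) + 1 + 1))) ^ (1 + σ) := by
        refine le_trans ?_ hB
        have : (1 + σ) / ((k : ℝ) + 1 + 1) ≤ (1 + σ) / ((k : ℝ) + 1) :=
          div_le_div_of_nonneg_left (by linarith) (by positivity) (by linarith)
        have h : (1 + σ) * -(1 / ((k : ℝ) + 1 + 1)) = -((1 + σ) / ((k : ℝ) + 1 + 1)) := by ring
        rw [h]
        linarith
      have hfin : (1 + -(1 / ((k : ℝ) + 1 + 1))) ^ (1 + σ) * (((k + 1 : ℕ) : ℝ) + 1) ^ (1 + σ) =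
          ((k : ℝ) + 1) ^ (1 + σ) := by
        have h : 1 + -(1 / ((k : ℝ) + 1 + 1)) = ((k : ℝ) + 1) / ((k : ℝ) + 1 + 1) := by
          field_simp
          ring
        push_cast
        rw [h, ← Real.mul_rpow (by positivity) hx.le, div_mul_cancel₀ _ hx.ne']
      rw [← hfin]
      exact mul_le_mul_of_nonneg_right (hr.trans hle) (hpow (k + 1)).le

theorem summable_inv_natCast_add_one_rpow {σ : ℝ} (hσ : 0 < σ) (C : ℝ) :
    Summable fun k : ℕ => C * (((k : ℝ) + 1) ^ (1 + σ))⁻¹ := by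
  have h := (summable_nat_add_iff 1).2 (Real.summable_nat_rpow_inv.2 (by linarith : 1 < 1 + σ))
  exact (h.congr fun k => by push_cast; rfl).mul_left C

theorem summable_hypTerm {c d e : ℂ} (hp : (c, d, e) ∈ hypDomain) (hs : 0 < (d + e - c - 2).re) :
    Summable fun k => hypTerm k (c, d, e) := by
  obtain ⟨σ, hσ, C, h⟩ := exists_eventually_norm_hypTerm_le hp hs
  exact Summable.of_norm_bounded (summable_inv_natCast_add_one_rpow hσ C) h.self_of_nhds

theorem tendsto_natCast_mul_hypTerm {c d e : ℂ} (hp : (c, d, e) ∈ hypDomain)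
    (hs : 0 < (d + e - c - 2).re) :
    Tendsto (fun k : ℕ => ((k : ℂ) + 1) * hypTerm k (c, d, e)) atTop (𝓝 0) := by
  obtain ⟨σ, hσ, C, h⟩ := exists_eventually_norm_hypTerm_le hp hs
  have h0 : Tendsto (fun k : ℕ => C * ((k : ℝ) + 1) ^ (-σ)) atTop (𝓝 0) := by
    have h1 := (tendsto_rpow_neg_atTop hσ).comp
      (tendsto_atTop_add_const_right _ (1 : ℝ) tendsto_natCast_atTop_atTop)
    simpa using h1.const_mul C
  refine squeeze_zero_norm (fun k => ?_) h0
  have hk : (0 : ℝ) < (k : ℝ) + 1 := by positivity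
  have hn1 : ‖(k : ℂ) + 1‖ = k + 1 := by
    rw [← Nat.cast_add_one, Complex.norm_natCast]; push_cast; ring
  rw [norm_mul, hn1]
  refine (mul_le_mul_of_nonneg_left (h.self_of_nhds k) hk.le).trans_eq ?_
  rw [Real.rpow_add hk, Real.rpow_one, Real.rpow_neg hk.le, mul_inv]
  field_simp

theorem differentiableAt_tsum_hypTerm {p₀ : ℂ × ℂ × ℂ} (hp₀ : p₀ ∈ hypDomain)
    (hs : 0 < (p₀.2.1 + p₀.2.2 - p₀.1 - 2).re) :
    DifferentiableAt ℂ (fun p => ∑' k, hypTerm k p) p₀ := by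
  obtain ⟨σ, hσ, C, h⟩ := exists_eventually_norm_hypTerm_le hp₀ hs
  refine differentiableAt_tsum_of_eventually_norm_le (summable_inv_natCast_add_one_rpow hσ C) ?_ h
  filter_upwards [isOpen_hypDomain.mem_nhds hp₀] with p hp k using differentiableAt_hypTerm hp k

/-! ### The holomorphic continuation of the hypergeometric value -/

/-- The combination of summands telescopes, with boundary term `d (e - 1 + N)` times the `N`-th
term, which vanishes in the limit because the terms decay faster than `1 / N`. The right side
involves excess one larger, and its only denominators are `d` and the excess; this is what drives
the continuation. -/
theorem tsum_hypTerm_recurrence {c d e : ℂ} (hp : (c, d, e) ∈ hypDomain)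
    (hs : 0 < (d + e - c - 2).re) :
    ∑' k, hypTerm k (c, d, e) =
      (d * (e - 1) + (d - 1) * (d - c) * ∑' k, hypTerm k (c, d + 1, e)) /
        ((d + e - c - 2) * d) := by
  have hd : ∀ k : ℕ, d + k ≠ 0 := fun k h => (hp k).1 (eq_neg_of_add_eq_zero_left h)
  have he : ∀ k : ℕ, e + k ≠ 0 := fun k h => (hp k).2.1 (eq_neg_of_add_eq_zero_left h)
  have hd0 : d ≠ 0 := by simpa using hd 0
  have hs0 : d + e - c - 2 ≠ 0 := fun h => by simp [h] at hs
  have hshift : ∀ k : ℕ, (d + k) * hypTerm k (c, d + 1, e) = d * hypTerm k (c, d, e) := by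
    intro k
    rw [hypTerm_add_one_snd k c e hd]
    field_simp [hd k]
  have hs' : 0 < (d + 1 + e - c - 2).re := by
    have : d + 1 + e - c - 2 = (d + e - c - 2) + 1 := by ring
    rw [this, Complex.add_re, Complex.one_re]
    linarith
  have hsum := summable_hypTerm hp hs
  have hsum' := summable_hypTerm (shift_mem_hypDomain hp) hs'
  set F := ∑' k, hypTerm k (c, d, e)
  set G := ∑' k, hypTerm k (c, d + 1, e)
  have hT : ∀ N : ℕ, ∑ k ∈ Finset.range N, ((d + e - c - 2) * d * hypTerm k (c, d, e) -
      (d - 1) * (d - c) * hypTerm k (c, d + 1, e)) =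
      d * (e - 1) - d * ((e - 1) + N) * hypTerm N (c, d, e) := by
    intro N
    induction N with
    | zero => simp [hypTerm]
    | succ N ih =>
      rw [Finset.sum_range_succ, ih, hypTerm_succ]
      have h1 := hd N
      have h2 := he N
      have h3 : hypTerm N (c, d, e) = (d + N) * hypTerm N (c, d + 1, e) / d := by
        rw [hshift, mul_div_cancel_left₀ _ hd0]
      rw [h3]
      push_cast
      field_simp
      ring
  have hlim0 : Tendsto (fun N : ℕ => hypTerm N (c, d, e)) atTop (𝓝 0) :=
    hsum.tendsto_atTop_zero
  have hlim1 : Tendsto (fun N : ℕ => d * (e - 1) - d * ((e - 1) + N) * hypTerm N (c, d, e))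
      atTop (𝓝 (d * (e - 1))) := by
    have h := ((tendsto_natCast_mul_hypTerm hp hs).const_mul d).add
      (hlim0.const_mul (d * (e - 2)))
    have h' := h.const_sub (d * (e - 1))
    simp only [mul_zero, add_zero, sub_zero] at h'
    refine h'.congr fun N => ?_
    ring
  have hlim2 := ((hsum.hasSum.mul_left ((d + e - c - 2) * d)).sub
    (hsum'.hasSum.mul_left ((d - 1) * (d - c)))).tendsto_sum_nat
  have := tendsto_nhds_unique (hlim2.congr hT) hlim1
  rw [eq_div_iff (mul_ne_zero hs0 hd0)]
  linear_combination this

/-- The continuation of `₃F₂(1, 1, c; d, e; 1)` to the parameters with `-n < Re (d + e - c - 2)`,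
obtained from `n` applications of a contiguous relation. -/
noncomputable def hypContinuation : ℕ → ℂ × ℂ × ℂ → ℂ
  | 0, p => ∑' k, hypTerm k p
  | n + 1, p => (p.2.1 * (p.2.2 - 1) +
      (p.2.1 - 1) * (p.2.1 - p.1) * hypContinuation n (p.1, p.2.1 + 1, p.2.2)) /
        ((p.2.1 + p.2.2 - p.1 - 2) * p.2.1)

theorem re_excess_shift (c d e : ℂ) :
    (d + 1 + e - c - 2).re = (d + e - c - 2).re + 1 := by
  simp
  ring

/-- At level zero this is the contiguous relation for the convergent series; higher levels follow
because `d ↦ d + 1` raises the excess by one. -/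
theorem hypContinuation_succ_eq (n : ℕ) {c d e : ℂ} (hp : (c, d, e) ∈ hypDomain)
    (hs : -(n : ℝ) < (d + e - c - 2).re) :
    hypContinuation (n + 1) (c, d, e) = hypContinuation n (c, d, e) := by
  induction n generalizing d with
  | zero => exact (tsum_hypTerm_recurrence hp (by simpa using hs)).symm
  | succ n ih =>
    have h := ih (shift_mem_hypDomain hp) (by rw [re_excess_shift]; push_cast at hs; linarith)
    rw [hypContinuation, h, hypContinuation]

theorem hypContinuation_eq_of_le {m n : ℕ} (hmn : m ≤ n) {p : ℂ × ℂ × ℂ} (hp : p ∈ hypDomain)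
    (hs : -(m : ℝ) < (p.2.1 + p.2.2 - p.1 - 2).re) :
    hypContinuation n p = hypContinuation m p := by
  induction n, hmn using Nat.le_induction with
  | base => rfl
  | succ n hn ih =>
    rw [← ih]
    have : (m : ℝ) ≤ n := Nat.cast_le.2 hn
    exact hypContinuation_succ_eq n hp (by linarith)

theorem differentiableAt_hypContinuation (n : ℕ) {p : ℂ × ℂ × ℂ} (hp : p ∈ hypDomain)
    (hs : -(n : ℝ) < (p.2.1 + p.2.2 - p.1 - 2).re) :
    DifferentiableAt ℂ (hypContinuation n) p := by
  induction n generalizing p with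
  | zero => exact differentiableAt_tsum_hypTerm hp (by simpa using hs)
  | succ n ih =>
    obtain ⟨c, d, e⟩ := p
    have h := ih (shift_mem_hypDomain hp)
      (by rw [re_excess_shift]; push_cast at hs; linarith)
    have hcomp : DifferentiableAt ℂ
        (fun p : ℂ × ℂ × ℂ => hypContinuation n (p.1, p.2.1 + 1, p.2.2)) (c, d, e) :=
      DifferentiableAt.comp (c, d, e) (f := fun p : ℂ × ℂ × ℂ => (p.1, p.2.1 + 1, p.2.2)) h
        (by fun_prop)
    have h0 := hp 0
    simp only [Nat.cast_zero, neg_zero] at h0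
    have hden : (d + e - c - 2) * d ≠ 0 := mul_ne_zero h0.2.2 h0.1
    change DifferentiableAt ℂ (fun p : ℂ × ℂ × ℂ => (p.2.1 * (p.2.2 - 1) +
      (p.2.1 - 1) * (p.2.1 - p.1) * hypContinuation n (p.1, p.2.1 + 1, p.2.2)) /
        ((p.2.1 + p.2.2 - p.1 - 2) * p.2.1)) (c, d, e)
    have hinv : DifferentiableAt ℂ
        (fun p : ℂ × ℂ × ℂ => ((p.2.1 + p.2.2 - p.1 - 2) * p.2.1)⁻¹) (c, d, e) :=
      DifferentiableAt.fun_inv (by fun_prop) hden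
    simp only [div_eq_mul_inv]
    fun_prop

theorem exists_isHypContinuation : ∃ Φ : ℂ × ℂ × ℂ → ℂ, IsHypContinuation Φ := by
  have hfloor : ∀ x : ℝ, -((⌊-x⌋₊ + 1 : ℕ) : ℝ) < x := fun x => by
    have := Nat.lt_floor_add_one (-x)
    push_cast
    linarith
  -- The number of steps jumps with `p`, but near a given point all admissible numbers of steps give
  -- the same value, so `Φ` coincides locally with a single `hypContinuation n`.
  let Φ : ℂ × ℂ × ℂ → ℂ := fun p =>
    hypContinuation (⌊-(p.2.1 + p.2.2 - p.1 - 2).re⌋₊ + 1) p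
  have hΦ : ∀ p ∈ hypDomain, ∀ n : ℕ, -(n : ℝ) < (p.2.1 + p.2.2 - p.1 - 2).re →
      Φ p = hypContinuation n p := by
    intro p hp n hn
    rcases le_total n (⌊-(p.2.1 + p.2.2 - p.1 - 2).re⌋₊ + 1) with h | h
    · exact hypContinuation_eq_of_le h hp hn
    · exact (hypContinuation_eq_of_le h hp (hfloor _)).symm
  refine ⟨Φ, fun p hp => ?_, fun c d e hp hs => ?_⟩
  · obtain ⟨n, hn⟩ : ∃ n : ℕ, -(n : ℝ) < (p.2.1 + p.2.2 - p.1 - 2).re := ⟨_, hfloor _⟩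
    refine DifferentiableAt.differentiableWithinAt ?_
    refine (differentiableAt_hypContinuation n hp hn).congr_of_eventuallyEq ?_
    have hcont : Continuous fun p : ℂ × ℂ × ℂ => (p.2.1 + p.2.2 - p.1 - 2).re :=
      Complex.continuous_re.comp (by fun_prop)
    filter_upwards [isOpen_hypDomain.mem_nhds hp, hcont.continuousAt.eventually_const_lt hn]
      with q hq hqn using hΦ q hq n hqn
  · rw [hΦ _ hp 0 (by simpa using hs), hyp3F2_one_eq_tsum]
    rfl

/-- Holomorphy and agreement with the series are all that is used about the chosen continuation; its
uniqueness plays no role below. -/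
theorem isHypContinuation_hyp3F2AtOne :
    IsHypContinuation (fun p : ℂ × ℂ × ℂ => hyp3F2AtOne p.1 p.2.1 p.2.2) := by
  have h := exists_isHypContinuation
  have heq : (fun p : ℂ × ℂ × ℂ => hyp3F2AtOne p.1 p.2.1 p.2.2) = h.choose := by
    funext p
    simp only [hyp3F2AtOne, dif_pos h]
  rw [heq]
  exact h.choose_spec

theorem hyp3F2AtOne_eq_tsum {c d e : ℂ} (hp : (c, d, e) ∈ hypDomain)
    (hs : 0 < (d + e - c - 2).re) : hyp3F2AtOne c d e = ∑' k, hypTerm k (c, d, e) :=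
  (isHypContinuation_hyp3F2AtOne.2 c d e hp hs).trans (hyp3F2_one_eq_tsum c d e)

/-! ### Sums over the poles of a Mellin transform -/

/-- The sum `∑ᵢ cᵢ / (w + mᵢ + 1)`, which is the integral of `x ^ w * ∑ᵢ cᵢ x ^ mᵢ` over `[0, 1]`. -/
noncomputable def monomialMellin {ι : Type*} [Fintype ι] (m : ι → ℕ) (c : ι → ℂ) (w : ℂ) : ℂ :=
  ∑ i, c i / (w + m i + 1)

/-- The sum `∑ₙ κⁿ g(w + r n)`. -/
noncomputable def lerchSum (κ : ℂ) (r : ℕ) (g : ℂ → ℂ) (w : ℂ) : ℂ :=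
  ∑' n : ℕ, κ ^ n * g (w + r * n)

/-- The terms of `lerchSum κ r g` are dominated by a summable sequence on `1 ≤ Re w`. -/
def LerchBound (κ : ℂ) (r : ℕ) (g : ℂ → ℂ) : Prop :=
  ∃ u : ℕ → ℝ, Summable u ∧ ∀ w : ℂ, 1 ≤ w.re → ∀ n : ℕ, ‖κ ^ n * g (w + r * n)‖ ≤ u n

section lerchSum

variable {κ : ℂ} {r : ℕ} {g : ℂ → ℂ}

/-- Dropping finitely many terms moves `w` into the half-plane `1 ≤ Re w`. No pole needs to be
avoided: a term there is finite by the convention for division by zero. -/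
theorem LerchBound.summable (h : LerchBound κ r g) (hr : 0 < r) (w : ℂ) :
    Summable fun n : ℕ => κ ^ n * g (w + r * n) := by
  obtain ⟨u, hu, hb⟩ := h
  obtain ⟨N, hN⟩ := exists_nat_ge (1 - w.re)
  rw [← summable_nat_add_iff N]
  have hre : 1 ≤ (w + r * N).re := by
    have : (1 : ℝ) ≤ r := by exact_mod_cast hr
    have hN0 : (0 : ℝ) ≤ N := N.cast_nonneg
    simp
    nlinarith
  refine ((Summable.of_norm_bounded hu (hb _ hre)).mul_left (κ ^ N)).congr fun n => ?_
  rw [pow_add]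
  push_cast
  rw [show w + r * N + r * n = w + r * ((n : ℂ) + N) by ring]
  ring

theorem lerchSum_eq_add (h : LerchBound κ r g) (hr : 0 < r) (w : ℂ) :
    lerchSum κ r g w = g w + κ * lerchSum κ r g (w + r) := by
  rw [lerchSum, (h.summable hr w).tsum_eq_zero_add, lerchSum, ← tsum_mul_left]
  congr 1
  · simp
  · refine tsum_congr fun n => ?_
    push_cast
    rw [show w + r * ((n : ℂ) + 1) = w + r + r * n by ring, pow_succ]
    ring

/-- On `1 < Re w` this is the `M`-test. Splitting off the first term and shifting by `r ≥ 1` extends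
it leftwards by unit strips, where only differentiability of the individual terms at `w` is needed.
-/
theorem differentiableAt_lerchSum (h : LerchBound κ r g) (hr : 0 < r)
    (hg : ∀ w : ℂ, 0 < w.re → DifferentiableAt ℂ g w) {w : ℂ}
    (hw : ∀ n : ℕ, DifferentiableAt ℂ g (w + r * n)) :
    DifferentiableAt ℂ (lerchSum κ r g) w := by
  have hr1 : (1 : ℝ) ≤ r := by exact_mod_cast hr
  have main : ∀ N : ℕ, ∀ w : ℂ, 1 - (N : ℝ) < w.re →
      (∀ n : ℕ, DifferentiableAt ℂ g (w + r * n)) →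
      DifferentiableAt ℂ (lerchSum κ r g) w := by
    intro N
    induction N with
    | zero =>
      intro w hw _
      obtain ⟨u, hu, hb⟩ := h
      have hev : ∀ᶠ z : ℂ in 𝓝 w, 1 < z.re :=
        Complex.continuous_re.continuousAt.eventually_const_lt (by simpa using hw)
      refine differentiableAt_tsum_of_eventually_norm_le hu ?_ ?_
      · filter_upwards [hev] with z hz k
        refine DifferentiableAt.const_mul ?_ _
        refine DifferentiableAt.comp z (f := fun z : ℂ => z + r * k) (hg _ ?_) (by fun_prop)
        have : (0 : ℝ) ≤ r * k := by positivity
        simp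
        linarith
      · filter_upwards [hev] with z hz k using hb z hz.le k
    | succ N ih =>
      intro w hw hd
      have heq : lerchSum κ r g = fun z => g z + κ * lerchSum κ r g (z + r) :=
        funext (lerchSum_eq_add h hr)
      rw [heq]
      refine DifferentiableAt.add (by simpa using hd 0) (DifferentiableAt.const_mul ?_ _)
      refine DifferentiableAt.comp w (f := fun z : ℂ => z + r) (ih _ ?_ ?_) (by fun_prop)
      · push_cast at hw
        simp
        linarith
      · intro n
        have := hd (n + 1)
        push_cast at this
        rwa [show w + r * ((n : ℂ) + 1) = w + r + r * n by ring] at this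
  obtain ⟨N, hN⟩ := exists_nat_gt (1 - w.re)
  exact main N w (by linarith) hw

end lerchSum

section monomialMellin

variable {ι : Type*} [Fintype ι] {m : ι → ℕ} {c : ι → ℂ}

theorem differentiableAt_monomialMellin {w : ℂ} (hw : ∀ i, w + m i + 1 ≠ 0) :
    DifferentiableAt ℂ (monomialMellin m c) w := by
  unfold monomialMellin
  refine DifferentiableAt.fun_sum fun i _ => ?_
  have : DifferentiableAt ℂ (fun w : ℂ => (w + m i + 1)⁻¹) w :=
    DifferentiableAt.fun_inv (by fun_prop) (hw i)
  simpa only [div_eq_mul_inv] using this.const_mul (c i)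

theorem differentiableAt_monomialMellin_of_re_pos {w : ℂ} (hw : 0 < w.re) :
    DifferentiableAt ℂ (monomialMellin m c) w := by
  refine differentiableAt_monomialMellin fun i h => ?_
  have h' := congrArg Complex.re h
  simp at h'
  have : (0 : ℝ) ≤ m i := by positivity
  linarith

theorem lerchBound_monomialMellin {κ : ℂ} (hκ : ‖κ‖ < 1) (r : ℕ) :
    LerchBound κ r (monomialMellin m c) := by
  refine ⟨fun n => ‖κ‖ ^ n * ∑ i, ‖c i‖,
    (summable_geometric_of_lt_one (norm_nonneg _) hκ).mul_right _, fun w hw n => ?_⟩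
  rw [norm_mul, norm_pow]
  refine mul_le_mul_of_nonneg_left ?_ (by positivity)
  refine (norm_sum_le _ _).trans (Finset.sum_le_sum fun i _ => ?_)
  rw [norm_div]
  refine div_le_self (norm_nonneg _) ?_
  refine le_trans ?_ (Complex.re_le_norm _)
  have h1 : (0 : ℝ) ≤ m i := by positivity
  have h2 : (0 : ℝ) ≤ r * n := by positivity
  simp
  linarith

/-- The series `∑ (-1)ⁿ / (w + n + 1)` does not converge absolutely. Pairing neighbours, `1 / (w +
1) - 1 / (w + 2) = 1 / ((w + 1)(w + 2))`, does give absolute convergence; hence `κ = 1` and step `2`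
instead of `κ = -1` and step `1`. -/
theorem lerchBound_monomialMellin_alternating :
    LerchBound 1 2 (monomialMellin ![0, 1] ![1, -1]) := by
  have hs : Summable fun n : ℕ => (((n : ℝ) + 1) ^ 2)⁻¹ := by
    have h := (summable_nat_add_iff 1).2 (Real.summable_nat_pow_inv.2 (one_lt_two))
    exact h.congr fun k => by push_cast; rfl
  refine ⟨_, hs, fun w hw n => ?_⟩
  have hn : (0 : ℝ) ≤ n := n.cast_nonneg
  have key : ∀ k : ℂ, 0 ≤ k.re → (n : ℝ) + 1 ≤ ‖w + 2 * n + k‖ := by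
    intro k hk
    refine le_trans ?_ (Complex.re_le_norm _)
    simp
    linarith
  have h1 := key 1 (by simp)
  have h2 := key 2 (by simp)
  have h1' : w + 2 * n + 1 ≠ 0 := norm_pos_iff.1 (by linarith)
  have h2' : w + 2 * n + 2 ≠ 0 := norm_pos_iff.1 (by linarith)
  have heq : (1 : ℂ) ^ n * monomialMellin ![0, 1] ![1, -1] (w + (2 : ℕ) * n) =
      ((w + 2 * n + 1) * (w + 2 * n + 2))⁻¹ := by
    simp only [monomialMellin, Fin.sum_univ_two, one_pow, one_mul, Matrix.cons_val_zero,
      Matrix.cons_val_one, Nat.cast_ofNat, Nat.cast_zero, Nat.cast_one, add_zero]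
    rw [show w + 2 * (n : ℂ) + 1 + 1 = w + 2 * n + 2 by ring]
    field_simp
    ring
  rw [heq, norm_inv, norm_mul, sq]
  gcongr

end monomialMellin

/-! ### Pochhammer integrals -/

theorem expTwoPiI_add (z w : ℂ) : expTwoPiI (z + w) = expTwoPiI z * expTwoPiI w := by
  simp only [expTwoPiI, mul_add, Complex.exp_add]

theorem expTwoPiI_natCast_mul (n : ℕ) (z : ℂ) : expTwoPiI (n * z) = expTwoPiI z ^ n := by
  rw [expTwoPiI, expTwoPiI, ← Complex.exp_nat_mul]
  congr 1
  ring

theorem expTwoPiI_natCast (n : ℕ) : expTwoPiI n = 1 := by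
  rw [expTwoPiI, ← Complex.exp_nat_mul_two_pi_mul_I n]
  congr 1
  ring

theorem norm_expTwoPiI_ofReal (t : ℝ) : ‖expTwoPiI t‖ = 1 := by
  rw [expTwoPiI, show 2 * (Real.pi : ℂ) * Complex.I * t = ((2 * Real.pi * t : ℝ) : ℂ) * Complex.I by
    push_cast; ring, Complex.norm_exp_ofReal_mul_I]

theorem expTwoPiI_ofReal_sub_one_ne_zero {a : ℝ} (ha : ∀ n : ℤ, a ≠ n) :
    expTwoPiI a - 1 ≠ 0 := by
  intro h
  rw [sub_eq_zero, expTwoPiI, Complex.exp_eq_one_iff] at h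
  obtain ⟨n, hn⟩ := h
  refine ha n ?_
  have h2 : (2 * (Real.pi : ℂ) * Complex.I) ≠ 0 := Complex.two_pi_I_ne_zero
  have : (a : ℂ) = n := mul_left_cancel₀ h2 (hn.trans (mul_comm _ _))
  exact_mod_cast this

theorem continuous_expTwoPiI : Continuous expTwoPiI := by
  unfold expTwoPiI
  fun_prop

/-- The closed unit disc without the point `-1`. -/
def puncturedUnitDisc : Set ℂ := {z | ‖z‖ ≤ 1 ∧ z ≠ -1}

section pochhammer

variable {ε a : ℝ} {f g : ℂ → ℂ}

theorem ofReal_mem_puncturedUnitDisc (hε : 0 < ε) {x : ℝ} (hx : x ∈ Set.Icc ε 1) :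
    (x : ℂ) ∈ puncturedUnitDisc := by
  have h0 : 0 < x := hε.trans_le hx.1
  refine ⟨by rw [Complex.norm_real, Real.norm_of_nonneg h0.le]; exact hx.2, fun h => ?_⟩
  have := congrArg Complex.re h
  simp at this
  linarith

theorem norm_circle (hε : 0 < ε) (t : ℝ) : ‖(ε : ℂ) * expTwoPiI t‖ = ε := by
  rw [norm_mul, norm_expTwoPiI_ofReal, Complex.norm_real, Real.norm_of_nonneg hε.le, mul_one]

theorem circle_mem_puncturedUnitDisc (hε : 0 < ε) (hε1 : ε < 1) (t : ℝ) :
    (ε : ℂ) * expTwoPiI t ∈ puncturedUnitDisc := by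
  refine ⟨(norm_circle hε t).trans_le hε1.le, fun h => ?_⟩
  have := norm_circle hε t
  rw [h] at this
  simp at this
  linarith

theorem continuousOn_segment (hε : 0 < ε) (hf : ContinuousOn f puncturedUnitDisc) :
    ContinuousOn (fun x : ℝ => f (x : ℂ)) (Set.Icc ε 1) :=
  hf.comp Complex.continuous_ofReal.continuousOn fun _ hx => ofReal_mem_puncturedUnitDisc hε hx

theorem continuous_circle (hε : 0 < ε) (hε1 : ε < 1) (hf : ContinuousOn f puncturedUnitDisc) :
    Continuous fun t : ℝ => f ((ε : ℂ) * expTwoPiI t) := by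
  rw [← continuousOn_univ]
  refine hf.comp (Continuous.continuousOn ?_) fun t _ => circle_mem_puncturedUnitDisc hε hε1 t
  exact continuous_const.mul (continuous_expTwoPiI.comp Complex.continuous_ofReal)

theorem continuousOn_segment_integrand (hε : 0 < ε) (a : ℝ)
    (hf : ContinuousOn f puncturedUnitDisc) :
    ContinuousOn (fun x : ℝ => ((x ^ a : ℝ) : ℂ) * f (x : ℂ)) (Set.Icc ε 1) := by
  refine ContinuousOn.mul ?_ (continuousOn_segment hε hf)
  refine Complex.continuous_ofReal.comp_continuousOn fun x hx => ?_
  exact (Real.continuousAt_rpow_const x a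
    (Or.inl (hε.trans_le hx.1).ne')).continuousWithinAt

theorem intervalIntegrable_segment (hε : 0 < ε) (hε1 : ε < 1) (a : ℝ)
    (hf : ContinuousOn f puncturedUnitDisc) :
    IntervalIntegrable (fun x : ℝ => ((x ^ a : ℝ) : ℂ) * f (x : ℂ)) MeasureTheory.volume ε 1 := by
  refine ContinuousOn.intervalIntegrable ?_
  rw [Set.uIcc_of_le hε1.le]
  exact continuousOn_segment_integrand hε a hf

theorem intervalIntegrable_circle (hε : 0 < ε) (hε1 : ε < 1) (a : ℝ)
    (hf : ContinuousOn f puncturedUnitDisc) :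
    IntervalIntegrable (fun t : ℝ => (((ε ^ a : ℝ) : ℂ) * expTwoPiI ((a * t : ℝ) : ℂ)) *
        f ((ε : ℂ) * expTwoPiI (t : ℂ)) *
        (2 * (Real.pi : ℂ) * Complex.I * (ε : ℂ) * expTwoPiI (t : ℂ)))
      MeasureTheory.volume 0 1 := by
  refine Continuous.intervalIntegrable ?_ _ _
  have h1 := continuous_circle hε hε1 hf
  have h2 : Continuous fun t : ℝ => expTwoPiI ((a * t : ℝ) : ℂ) :=
    continuous_expTwoPiI.comp (Complex.continuous_ofReal.comp (by fun_prop))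
  have h3 : Continuous fun t : ℝ => expTwoPiI (t : ℂ) :=
    continuous_expTwoPiI.comp Complex.continuous_ofReal
  exact ((continuous_const.mul h2).mul h1).mul (continuous_const.mul h3)

theorem pochhammerFormula_congr (hε : 0 < ε) (hε1 : ε < 1) (hfg : Set.EqOn f g puncturedUnitDisc) :
    pochhammerFormula ε a f = pochhammerFormula ε a g := by
  unfold pochhammerFormula
  congr 1
  · refine intervalIntegral.integral_congr fun x hx => ?_
    rw [Set.uIcc_of_le hε1.le] at hx
    simp only [hfg (ofReal_mem_puncturedUnitDisc hε hx)]
  · congr 1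
    refine intervalIntegral.integral_congr fun t _ => ?_
    simp only [hfg (circle_mem_puncturedUnitDisc hε hε1 t)]

theorem pochhammerFormula_add (hε : 0 < ε) (hε1 : ε < 1) (hf : ContinuousOn f puncturedUnitDisc)
    (hg : ContinuousOn g puncturedUnitDisc) :
    pochhammerFormula ε a (fun x => f x + g x) =
      pochhammerFormula ε a f + pochhammerFormula ε a g := by
  unfold pochhammerFormula
  simp only [mul_add, add_mul]
  rw [intervalIntegral.integral_add (intervalIntegrable_segment hε hε1 a hf)
    (intervalIntegrable_segment hε hε1 a hg),
    intervalIntegral.integral_add (intervalIntegrable_circle hε hε1 a hf)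
    (intervalIntegrable_circle hε hε1 a hg)]
  ring

theorem pochhammerFormula_const_mul (c : ℂ) :
    pochhammerFormula ε a (fun x => c * f x) = c * pochhammerFormula ε a f := by
  unfold pochhammerFormula
  have h1 : ∀ x : ℝ, ((x ^ a : ℝ) : ℂ) * (c * f x) = c * (((x ^ a : ℝ) : ℂ) * f x) :=
    fun x => by ring
  have h2 : ∀ t : ℝ, (((ε ^ a : ℝ) : ℂ) * expTwoPiI ((a * t : ℝ) : ℂ)) *
        (c * f ((ε : ℂ) * expTwoPiI (t : ℂ))) *
        (2 * (Real.pi : ℂ) * Complex.I * (ε : ℂ) * expTwoPiI (t : ℂ)) =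
      c * ((((ε ^ a : ℝ) : ℂ) * expTwoPiI ((a * t : ℝ) : ℂ)) *
        f ((ε : ℂ) * expTwoPiI (t : ℂ)) *
        (2 * (Real.pi : ℂ) * Complex.I * (ε : ℂ) * expTwoPiI (t : ℂ))) := fun t => by ring
  simp only [h1, h2, intervalIntegral.integral_const_mul]
  ring

theorem pochhammerFormula_sum {ι : Type*} (s : Finset ι) (hε : 0 < ε) (hε1 : ε < 1)
    {F : ι → ℂ → ℂ} (hF : ∀ i ∈ s, ContinuousOn (F i) puncturedUnitDisc) :
    pochhammerFormula ε a (fun x => ∑ i ∈ s, F i x) = ∑ i ∈ s, pochhammerFormula ε a (F i) := by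
  classical
  induction s using Finset.induction_on with
  | empty => simp [pochhammerFormula]
  | insert i s hi ih =>
    simp only [Finset.sum_insert hi]
    rw [pochhammerFormula_add hε hε1 (hF i (Finset.mem_insert_self i s))
      (continuousOn_finsetSum s fun j hj => hF j (Finset.mem_insert_of_mem hj)),
      ih fun j hj => hF j (Finset.mem_insert_of_mem hj)]

theorem expTwoPiI_add_natCast (z : ℂ) (n : ℕ) : expTwoPiI (z + n) = expTwoPiI z := by
  rw [expTwoPiI_add, expTwoPiI_natCast, mul_one]

/-- An integral power can be absorbed into the exponent because `𝐞(a + r) = 𝐞(a)` leaves the factor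
in front of the circle integral unchanged. -/
theorem pochhammerFormula_pow_mul (hε : 0 < ε) (hε1 : ε < 1) (r : ℕ) :
    pochhammerFormula ε a (fun x => x ^ r * f x) = pochhammerFormula ε (a + r) f := by
  unfold pochhammerFormula
  congr 1
  · refine intervalIntegral.integral_congr fun x hx => ?_
    rw [Set.uIcc_of_le hε1.le] at hx
    simp only [Real.rpow_add_natCast (hε.trans_le hx.1).ne']
    push_cast
    ring
  · congr 1
    · push_cast
      rw [expTwoPiI_add_natCast]
    · refine intervalIntegral.integral_congr fun t _ => ?_
      simp only [Real.rpow_add_natCast hε.ne', add_mul]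
      push_cast
      rw [expTwoPiI_add, expTwoPiI_natCast_mul]
      ring

/-- The segment contributes `(1 - ε ^ (a + 1)) / (a + 1)`. The circle returns exactly the missing `ε
^ (a + 1) / (a + 1)`, its primitive changing by the factor `𝐞(a)` over one turn. -/
theorem pochhammerFormula_one (hε : 0 < ε) (hε1 : ε < 1) (ha : ∀ n : ℤ, a ≠ n) :
    pochhammerFormula ε a (fun _ => 1) = 1 / ((a : ℂ) + 1) := by
  have ha1 : a + 1 ≠ 0 := fun h => ha (-1) (by push_cast; linarith)
  have ha1' : (a : ℂ) + 1 ≠ 0 := by exact_mod_cast ha1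
  have hI := Complex.two_pi_I_ne_zero
  have h1 : ∫ x in ε..1, ((x ^ a : ℝ) : ℂ) * 1 = ((1 - ε ^ (a + 1) : ℝ) : ℂ) / (a + 1) := by
    simp only [mul_one]
    rw [intervalIntegral.integral_ofReal, integral_rpow]
    · push_cast
      rw [Real.one_rpow]
      norm_num
    · refine Or.inr ⟨fun h => ha1 (by linarith), ?_⟩
      rw [Set.uIcc_of_le hε1.le]
      exact fun h => absurd h.1 (not_le.2 hε)
  have h2 : ∫ t in (0 : ℝ)..1, (((ε ^ a : ℝ) : ℂ) * expTwoPiI ((a * t : ℝ) : ℂ)) * 1 *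
        (2 * (Real.pi : ℂ) * Complex.I * (ε : ℂ) * expTwoPiI (t : ℂ)) =
      ((ε ^ (a + 1) : ℝ) : ℂ) / (a + 1) * (expTwoPiI a - 1) := by
    have hc : (2 * (Real.pi : ℂ) * Complex.I * (a + 1)) ≠ 0 := mul_ne_zero hI ha1'
    have h3 : ∀ t : ℝ, (((ε ^ a : ℝ) : ℂ) * expTwoPiI ((a * t : ℝ) : ℂ)) * 1 *
        (2 * (Real.pi : ℂ) * Complex.I * (ε : ℂ) * expTwoPiI (t : ℂ)) =
        ((ε ^ (a + 1) : ℝ) : ℂ) * (2 * (Real.pi : ℂ) * Complex.I) *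
          Complex.exp ((2 * (Real.pi : ℂ) * Complex.I * (a + 1)) * t) := by
      intro t
      have : Complex.exp ((2 * (Real.pi : ℂ) * Complex.I * (a + 1)) * t) =
          expTwoPiI ((a * t : ℝ) : ℂ) * expTwoPiI t := by
        rw [← expTwoPiI_add, expTwoPiI]
        congr 1
        push_cast
        ring
      rw [this, Real.rpow_add_one hε.ne']
      push_cast
      ring
    simp only [h3]
    rw [intervalIntegral.integral_const_mul, integral_exp_mul_complex hc]
    have h4 : Complex.exp (2 * (Real.pi : ℂ) * Complex.I * (a + 1) * ((1 : ℝ) : ℂ)) =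
        expTwoPiI a := by
      rw [← expTwoPiI_add_natCast a 1, expTwoPiI]
      congr 1
      push_cast
      ring
    rw [h4]
    simp only [Complex.ofReal_zero, mul_zero, Complex.exp_zero]
    field_simp
  unfold pochhammerFormula
  rw [h1, h2]
  have := expTwoPiI_ofReal_sub_one_ne_zero ha
  push_cast
  field_simp
  ring

theorem ne_intCast_add_natCast (ha : ∀ n : ℤ, a ≠ n) (k : ℕ) : ∀ n : ℤ, a + k ≠ n :=
  fun n h => ha (n - k) (by push_cast; linarith)

/-! ### Difference equation in the exponent and evaluation as a series. -/

theorem pochhammerFormula_functional_equation {ι : Type*} [Fintype ι] {m : ι → ℕ} {c : ι → ℂ}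
    {κ : ℂ} {r : ℕ} (hε : 0 < ε) (hε1 : ε < 1) (ha : ∀ n : ℤ, a ≠ n)
    (hf : ContinuousOn f puncturedUnitDisc)
    (heq : ∀ z ∈ puncturedUnitDisc, f z = (∑ i, c i * z ^ m i) + κ * (z ^ r * f z)) :
    pochhammerFormula ε a f = monomialMellin m c a + κ * pochhammerFormula ε (a + r) f := by
  rw [pochhammerFormula_congr hε hε1 heq, pochhammerFormula_add hε hε1 (by fun_prop) (by fun_prop),
    pochhammerFormula_sum _ hε hε1 (fun i _ => by fun_prop), pochhammerFormula_const_mul,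
    pochhammerFormula_pow_mul hε hε1]
  congr 1
  refine Finset.sum_congr rfl fun i _ => ?_
  have h := pochhammerFormula_pow_mul (f := fun _ => 1) (a := a) hε hε1 (m i)
  simp only [mul_one] at h
  rw [pochhammerFormula_const_mul, h, pochhammerFormula_one hε hε1 (ne_intCast_add_natCast ha _)]
  push_cast
  ring

/-- For exponent `b`, the segment is bounded by `C / (b + 1)` and the circle by a constant times `ε
^ b`. The factor `1 / (𝐞(b) - 1)` is constant along `b = a + r N`. -/
theorem tendsto_pochhammerFormula_zero (hε : 0 < ε) (hε1 : ε < 1)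
    (hf : ContinuousOn f puncturedUnitDisc) {r : ℕ} (hr : 0 < r) :
    Tendsto (fun N : ℕ => pochhammerFormula ε (a + (r * N : ℕ)) f) atTop (𝓝 0) := by
  obtain ⟨C, hC⟩ := isCompact_Icc.exists_bound_of_continuousOn (continuousOn_segment hε hf)
  obtain ⟨M, hM⟩ := (isCompact_Icc (a := (0 : ℝ)) (b := 1)).exists_bound_of_continuousOn
    (continuous_circle hε hε1 hf).continuousOn
  have htop : Tendsto (fun N : ℕ => a + ((r * N : ℕ) : ℝ)) atTop atTop := by
    refine tendsto_atTop_add_const_left _ _ (tendsto_natCast_atTop_atTop.comp ?_)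
    exact tendsto_id.const_mul_atTop' hr
  have hsq : Tendsto (fun b : ℝ => C * (b + 1)⁻¹ +
      ‖1 / (expTwoPiI a - 1)‖ * (ε ^ b * (M * (2 * Real.pi * ε)))) atTop (𝓝 0) := by
    have h1 := (tendsto_inv_atTop_zero.comp
      (tendsto_atTop_add_const_right _ (1 : ℝ) tendsto_id)).const_mul C
    have h2 := ((tendsto_rpow_atTop_of_base_lt_one ε (by linarith) hε1).mul_const
      (M * (2 * Real.pi * ε))).const_mul ‖1 / (expTwoPiI a - 1)‖
    simpa using h1.add h2
  refine squeeze_zero_norm' ?_ (hsq.comp htop)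
  filter_upwards [htop.eventually_gt_atTop 0] with N hN
  have hexp : expTwoPiI ((a + ((r * N : ℕ) : ℝ) : ℝ) : ℂ) = expTwoPiI a := by
    rw [Complex.ofReal_add, Complex.ofReal_natCast, expTwoPiI_add_natCast]
  simp only [Function.comp]
  unfold pochhammerFormula
  rw [hexp]
  set b := a + ((r * N : ℕ) : ℝ) with hb
  have hεb : 0 < ε ^ b := Real.rpow_pos_of_pos hε b
  refine (norm_add_le _ _).trans (add_le_add ?_ ?_)
  · have hC0 : 0 ≤ C := (norm_nonneg _).trans (hC 1 ⟨hε1.le, le_rfl⟩)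
    have hint : IntervalIntegrable (fun x : ℝ => C * x ^ b) MeasureTheory.volume ε 1 :=
      (intervalIntegral.intervalIntegrable_rpow' (by linarith)).const_mul C
    have h1 : ‖∫ x in ε..1, ((x ^ b : ℝ) : ℂ) * f x‖ ≤ ∫ x in ε..1, C * x ^ b := by
      refine intervalIntegral.norm_integral_le_of_norm_le hε1.le (MeasureTheory.ae_of_all _ fun x hx => ?_) hint
      have hx0 : 0 < x := hε.trans hx.1
      rw [norm_mul, Complex.norm_real, Real.norm_of_nonneg (Real.rpow_nonneg hx0.le b), mul_comm]
      exact mul_le_mul_of_nonneg_right (hC x ⟨hx.1.le, hx.2⟩) (Real.rpow_nonneg hx0.le b)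
    refine h1.trans ?_
    rw [intervalIntegral.integral_const_mul, integral_rpow (Or.inl (by linarith)), Real.one_rpow]
    refine mul_le_mul_of_nonneg_left ?_ hC0
    rw [div_eq_mul_inv]
    refine mul_le_of_le_one_left (by positivity) ?_
    linarith [Real.rpow_pos_of_pos hε (b + 1)]
  · rw [norm_mul]
    refine mul_le_mul_of_nonneg_left ?_ (norm_nonneg _)
    have h2 := intervalIntegral.norm_integral_le_of_norm_le_const (a := (0 : ℝ)) (b := 1)
      (f := fun t : ℝ => (((ε ^ b : ℝ) : ℂ) * expTwoPiI ((b * t : ℝ) : ℂ)) *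
        f ((ε : ℂ) * expTwoPiI (t : ℂ)) *
        (2 * (Real.pi : ℂ) * Complex.I * (ε : ℂ) * expTwoPiI (t : ℂ)))
      (C := ε ^ b * (M * (2 * Real.pi * ε))) (fun t ht => ?_)
    · simpa using h2
    rw [Set.uIoc_of_le zero_le_one] at ht
    simp only [norm_mul, norm_expTwoPiI_ofReal, Complex.norm_real, Complex.norm_I,
      Real.norm_of_nonneg hεb.le, Real.norm_of_nonneg hε.le, Real.norm_of_nonneg Real.pi_pos.le,
      Complex.norm_ofNat, mul_one, one_mul, mul_assoc]
    have hM0 : 0 ≤ M := (norm_nonneg _).trans (hM 0 ⟨le_rfl, zero_le_one⟩)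
    gcongr
    exact hM t ⟨ht.1.le, ht.2⟩

section evaluation

variable {ι : Type*} [Fintype ι] {m : ι → ℕ} {c : ι → ℂ} {κ : ℂ} {r : ℕ}

/-- After `N` uses of the difference equation the remainder is `κ ^ N` times an integral that itself
tends to zero, so `‖κ‖ = 1` is allowed. -/
theorem pochhammerFormula_eq_lerchSum (hε : 0 < ε) (hε1 : ε < 1) (ha : ∀ n : ℤ, a ≠ n)
    (hf : ContinuousOn f puncturedUnitDisc)
    (heq : ∀ z ∈ puncturedUnitDisc, f z = (∑ i, c i * z ^ m i) + κ * (z ^ r * f z))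
    (hκ : ‖κ‖ ≤ 1) (hr : 0 < r) (hb : LerchBound κ r (monomialMellin m c)) :
    pochhammerFormula ε a f = lerchSum κ r (monomialMellin m c) a := by
  have hN : ∀ N : ℕ, ∑ n ∈ Finset.range N, κ ^ n * monomialMellin m c ((a : ℂ) + r * n) =
      pochhammerFormula ε a f - κ ^ N * pochhammerFormula ε (a + (r * N : ℕ)) f := by
    intro N
    induction N with
    | zero => simp
    | succ N ih =>
      rw [Finset.sum_range_succ, ih, pochhammerFormula_functional_equation hε hε1
        (ne_intCast_add_natCast ha (r * N)) hf heq,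
        show a + ((r * N : ℕ) : ℝ) + r = a + ((r * (N + 1) : ℕ) : ℝ) by push_cast; ring, pow_succ]
      push_cast
      ring
  have h0 : Tendsto (fun N : ℕ => κ ^ N * pochhammerFormula ε (a + (r * N : ℕ)) f) atTop (𝓝 0) := by
    refine squeeze_zero_norm (fun N => ?_)
      (tendsto_zero_iff_norm_tendsto_zero.1 (tendsto_pochhammerFormula_zero (a := a) hε hε1 hf hr))
    rw [norm_mul, norm_pow]
    exact mul_le_of_le_one_left (norm_nonneg _) (pow_le_one₀ (norm_nonneg _) hκ)
  have h1 := (h0.const_sub (pochhammerFormula ε a f)).congr fun N => (hN N).symm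
  rw [sub_zero] at h1
  exact tendsto_nhds_unique h1 (hb.summable hr a).hasSum.tendsto_sum_nat

theorem pochhammerIntegral_eq_lerchSum (hε : 0 < ε) (hε1 : ε < 1)
    (hf : ContinuousOn f puncturedUnitDisc)
    (heq : ∀ z ∈ puncturedUnitDisc, f z = (∑ i, c i * z ^ m i) + κ * (z ^ r * f z))
    (hκ : ‖κ‖ ≤ 1) (hr : 0 < r) (hb : LerchBound κ r (monomialMellin m c))
    (ha : ∀ (n : ℕ) (i : ι), (a : ℂ) + r * n + m i + 1 ≠ 0) :
    pochhammerIntegral ε a f = lerchSum κ r (monomialMellin m c) a := by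
  unfold pochhammerIntegral
  split_ifs with h
  · obtain ⟨n₀, rfl⟩ := h
    refine Tendsto.limUnder_eq ?_
    have hcont : ContinuousAt (fun x : ℝ => lerchSum κ r (monomialMellin m c) (x : ℂ)) (n₀ : ℝ) :=
      ContinuousAt.comp (f := fun x : ℝ => (x : ℂ)) (differentiableAt_lerchSum hb hr
        (fun w hw => differentiableAt_monomialMellin_of_re_pos hw)
        (fun n => differentiableAt_monomialMellin (ha n))).continuousAt
        Complex.continuous_ofReal.continuousAt
    refine (hcont.tendsto.mono_left nhdsWithin_le_nhds).congr' ?_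
    -- Within distance one of `n₀` the only integer is `n₀`, so the evaluation for non-integral
    -- exponents applies on a punctured neighbourhood.
    have hnear : ∀ᶠ x : ℝ in 𝓝 (n₀ : ℝ), |x - n₀| < 1 := by
      have := Metric.ball_mem_nhds (n₀ : ℝ) one_pos
      filter_upwards [this] with x hx
      rwa [Metric.mem_ball, Real.dist_eq] at hx
    filter_upwards [nhdsWithin_le_nhds hnear, self_mem_nhdsWithin] with x hx hne
    refine (pochhammerFormula_eq_lerchSum hε hε1 (fun n hn => hne ?_) hf heq hκ hr hb).symm
    rw [hn] at hx ⊢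
    have h1 : |n - n₀| < 1 := by exact_mod_cast hx
    rw [Int.abs_lt_one_iff, sub_eq_zero] at h1
    rw [h1]
    rfl
  · exact pochhammerFormula_eq_lerchSum hε hε1 (fun n hn => h ⟨n, hn⟩) hf heq hκ hr hb

end evaluation

end pochhammer

/-! ### Contiguous relations for real parameters -/

/-- The pattern of every contiguous relation below: `b` is a summand times a rational function of
`k`, and the inhomogeneous term is `b 0`. -/
theorem tsum_of_telescoping {T T' b : ℕ → ℂ} {A B : ℂ} (hT : Summable T) (hT' : Summable T')
    (h : ∀ k, A * T k + B * T' k = b k - b (k + 1)) (hb : Tendsto b atTop (𝓝 0)) :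
    A * ∑' k, T k + B * ∑' k, T' k = b 0 := by
  have h1 := ((hT.hasSum.mul_left A).add (hT'.hasSum.mul_left B)).tendsto_sum_nat
  simp only [h, Finset.sum_range_sub'] at h1
  have h2 := hb.const_sub (b 0)
  rw [sub_zero] at h2
  exact tendsto_nhds_unique h1 h2

theorem norm_ofReal_add_natCast {x : ℝ} (hx : 0 ≤ x) (k : ℕ) : ‖(x : ℂ) + k‖ = x + k := by
  rw [← Complex.ofReal_natCast, ← Complex.ofReal_add, Complex.norm_of_nonneg (by positivity)]

/-- Real parameters `(c, d, e)` for which the terms of `₃F₂(1, 1, c; d, e; 1)` decay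
uniformly. -/
def GoodParameters (c d e : ℝ) : Prop := 0 < c ∧ 4 ≤ d ∧ 4 ≤ e ∧ (c ≤ d ∨ c ≤ e)

/-- After exchanging `d` and `e` if necessary, the ratio of consecutive terms is at most `1 * (k +
1) / (k + 4)`, and these bounds multiply to `6 / ((k + 1)(k + 2)(k + 3))`. The bound does not depend
on the parameters, so decay of a left hand side can be read off from its prefactor. -/
theorem norm_hypTerm_le {c d e : ℝ} (h : GoodParameters c d e) (k : ℕ) :
    ‖hypTerm k ((c : ℂ), (d : ℂ), (e : ℂ))‖ ≤ 6 * (((k : ℝ) + 1) ^ 3)⁻¹ := by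
  obtain ⟨hc, hd, he, hcde⟩ := h
  wlog hcd : c ≤ d generalizing d e
  · rw [hypTerm_swap]
    exact this he hd hcde.symm (hcde.resolve_left hcd)
  have key : ‖hypTerm k ((c : ℂ), (d : ℂ), (e : ℂ))‖ ≤
      6 / (((k : ℝ) + 1) * (k + 2) * (k + 3)) := by
    induction k with
    | zero => norm_num [hypTerm]
    | succ k ih =>
      have hk : (0 : ℝ) ≤ k := k.cast_nonneg
      rw [hypTerm_succ, norm_mul]
      have hn1 : ‖(k : ℂ) + 1‖ = k + 1 := by
        rw [← Nat.cast_add_one, Complex.norm_natCast]; push_cast; ring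
      have h1 : ‖((k : ℂ) + 1) * (c + k) / ((d + k) * (e + k))‖ ≤ ((k : ℝ) + 1) / (k + 4) := by
        rw [norm_div, norm_mul, norm_mul, hn1, norm_ofReal_add_natCast hc.le,
          norm_ofReal_add_natCast (by linarith), norm_ofReal_add_natCast (by linarith),
          mul_comm, mul_div_mul_comm]
        calc (c + k) / (d + k) * (((k : ℝ) + 1) / (e + k)) ≤ 1 * ((k + 1) / (k + 4)) := by
              refine mul_le_mul ?_ ?_ (by positivity) zero_le_one
              · exact div_le_one_of_le₀ (by linarith) (by linarith)
              · exact div_le_div_of_nonneg_left (by linarith) (by linarith) (by linarith)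
          _ = _ := one_mul _
      refine (mul_le_mul ih h1 (norm_nonneg _) (by positivity)).trans_eq ?_
      push_cast
      field_simp
      ring
  refine key.trans ?_
  rw [← div_eq_mul_inv]
  have hk : (0 : ℝ) ≤ k := k.cast_nonneg
  refine div_le_div_of_nonneg_left (by norm_num) (by positivity) ?_
  nlinarith [mul_nonneg hk hk]

theorem summable_six_mul_inv_cube : Summable fun k : ℕ => 6 * (((k : ℝ) + 1) ^ 3)⁻¹ := by
  have h := (summable_nat_add_iff 1).2 (Real.summable_nat_pow_inv.2 (by norm_num : 1 < 3))
  exact (h.congr fun k => by push_cast; rfl).mul_left 6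

theorem GoodParameters.summable {c d e : ℝ} (h : GoodParameters c d e) :
    Summable fun k => hypTerm k ((c : ℂ), (d : ℂ), (e : ℂ)) :=
  Summable.of_norm_bounded summable_six_mul_inv_cube (norm_hypTerm_le h)

theorem GoodParameters.norm_tsum_le {c d e : ℝ} (h : GoodParameters c d e) :
    ‖∑' k, hypTerm k ((c : ℂ), (d : ℂ), (e : ℂ))‖ ≤ ∑' k : ℕ, 6 * (((k : ℝ) + 1) ^ 3)⁻¹ :=
  tsum_of_norm_bounded summable_six_mul_inv_cube.hasSum (norm_hypTerm_le h)

theorem GoodParameters.mem_hypDomain {c d e : ℝ} (h : GoodParameters c d e)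
    (hs : 0 < d + e - c - 2) : ((c : ℂ), (d : ℂ), (e : ℂ)) ∈ hypDomain := by
  have key : ∀ x : ℝ, 0 < x → ∀ n : ℕ, (x : ℂ) ≠ -(n : ℂ) := by
    intro x hx n h
    have : x = -(n : ℝ) := by exact_mod_cast h
    have hn : (0 : ℝ) ≤ n := n.cast_nonneg
    linarith
  intro n
  refine ⟨key d (by linarith [h.2.1]) n, key e (by linarith [h.2.2.1]) n, ?_⟩
  have := key _ hs n
  push_cast at this
  exact this

theorem GoodParameters.hyp3F2AtOne_eq {c d e : ℝ} (h : GoodParameters c d e) :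
    hyp3F2AtOne c d e = ∑' k, hypTerm k ((c : ℂ), (d : ℂ), (e : ℂ)) := by
  have hs : 0 < d + e - c - 2 := by
    obtain ⟨-, h2, h3, h4 | h4⟩ := h <;> linarith
  refine hyp3F2AtOne_eq_tsum (h.mem_hypDomain hs) ?_
  have : (d : ℂ) + e - c - 2 = ((d + e - c - 2 : ℝ) : ℂ) := by push_cast; ring
  rwa [this, Complex.ofReal_re]

theorem GoodParameters.tendsto_mul {c d e : ℝ} (h : GoodParameters c d e) {ρ : ℕ → ℂ} {C : ℝ}
    (hρ : ∀ k : ℕ, ‖ρ k‖ ≤ C * (k + 1)) :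
    Tendsto (fun k => hypTerm k ((c : ℂ), (d : ℂ), (e : ℂ)) * ρ k) atTop (𝓝 0) := by
  have h0 : Tendsto (fun k : ℕ => 6 * C * (((k : ℝ) + 1)⁻¹ * ((k : ℝ) + 1)⁻¹)) atTop (𝓝 0) := by
    have h1 : Tendsto (fun k : ℕ => ((k : ℝ) + 1)⁻¹) atTop (𝓝 0) :=
      tendsto_inv_atTop_zero.comp
        (tendsto_atTop_add_const_right _ (1 : ℝ) tendsto_natCast_atTop_atTop)
    simpa using (h1.mul h1).const_mul (6 * C)
  refine squeeze_zero_norm (fun k => ?_) h0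
  rw [norm_mul]
  refine (mul_le_mul (norm_hypTerm_le h k) (hρ k) (norm_nonneg _) (by positivity)).trans_eq ?_
  have : (k : ℝ) + 1 ≠ 0 := by positivity
  field_simp

/-- Certificates are polynomials in `k` divided by factors `d + k` or `e + k`. The degree bounds
here, with `norm_div_ofReal_add_natCast_le`, show linear growth at most, which
`GoodParameters.tendsto_mul` tolerates. -/
theorem norm_linear_le (x₀ x₁ : ℂ) (k : ℕ) : ‖x₀ + x₁ * k‖ ≤ (‖x₀‖ + ‖x₁‖) * ((k : ℝ) + 1) := by
  refine (norm_add_le _ _).trans ?_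
  rw [norm_mul, Complex.norm_natCast]
  have hk : (0 : ℝ) ≤ k := k.cast_nonneg
  nlinarith [norm_nonneg x₀, norm_nonneg x₁, mul_nonneg (norm_nonneg x₀) hk]

theorem norm_quadratic_le (x₀ x₁ x₂ : ℂ) (k : ℕ) :
    ‖x₀ + (x₁ + x₂ * k) * k‖ ≤ (‖x₀‖ + (‖x₁‖ + ‖x₂‖)) * ((k : ℝ) + 1) ^ 2 := by
  refine (norm_add_le _ _).trans ?_
  rw [norm_mul, Complex.norm_natCast]
  have hk : (0 : ℝ) ≤ k := k.cast_nonneg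
  have h1 := norm_linear_le x₁ x₂ k
  have h2 : ‖x₁ + x₂ * k‖ * k ≤ (‖x₁‖ + ‖x₂‖) * ((k : ℝ) + 1) * (k + 1) :=
    mul_le_mul h1 (by linarith) hk (by positivity)
  have h3 : ‖x₀‖ ≤ ‖x₀‖ * ((k : ℝ) + 1) ^ 2 :=
    le_mul_of_one_le_right (norm_nonneg _) (by nlinarith)
  nlinarith

theorem norm_cubic_le (x₀ x₁ x₂ x₃ : ℂ) (k : ℕ) :
    ‖x₀ + (x₁ + (x₂ + x₃ * k) * k) * k‖ ≤
      (‖x₀‖ + (‖x₁‖ + (‖x₂‖ + ‖x₃‖))) * ((k : ℝ) + 1) ^ 3 := by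
  refine (norm_add_le _ _).trans ?_
  rw [norm_mul, Complex.norm_natCast]
  have hk : (0 : ℝ) ≤ k := k.cast_nonneg
  have h1 := norm_quadratic_le x₁ x₂ x₃ k
  have h2 : ‖x₁ + (x₂ + x₃ * k) * k‖ * k ≤
      (‖x₁‖ + (‖x₂‖ + ‖x₃‖)) * ((k : ℝ) + 1) ^ 2 * (k + 1) :=
    mul_le_mul h1 (by linarith) hk (by positivity)
  have h3 : ‖x₀‖ ≤ ‖x₀‖ * ((k : ℝ) + 1) ^ 3 :=
    le_mul_of_one_le_right (norm_nonneg _) (one_le_pow₀ (by linarith))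
  nlinarith

theorem ofReal_add_natCast_ne_zero {x : ℝ} (hx : 0 < x) (k : ℕ) : (x : ℂ) + k ≠ 0 := by
  rw [← norm_pos_iff, norm_ofReal_add_natCast hx.le]
  positivity

/-! ### The telescoping certificates of the four contiguous relations. -/

/-- The shift `β ↦ β + 1` raises `c`, `d` and `e` by one each. Expressing all summands through one
of them reduces the telescoping to a polynomial identity. -/
theorem alternating_contiguous {α c d e : ℝ} (hd : d = c + 1 - α) (he : e = c + 1 + α)
    (h : GoodParameters c d e) (h' : GoodParameters (c + 1) (d + 1) (e + 1)) :
    (α : ℂ) / ((d - 1) * (e - 1)) * ∑' k, hypTerm k ((c : ℂ), (d : ℂ), (e : ℂ)) +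
      α / (d * e) * ∑' k, hypTerm k ((c : ℂ) + 1, (d : ℂ) + 1, (e : ℂ) + 1) =
    2 * α / ((d - 1) * (e - 1)) := by
  have hc0 : (c : ℂ) ≠ 0 := by exact_mod_cast h.1.ne'
  have hdn := ofReal_add_natCast_ne_zero (x := d) (by linarith [h.2.1])
  have hen := ofReal_add_natCast_ne_zero (x := e) (by linarith [h.2.2.1])
  have hd0 : (d : ℂ) ≠ 0 := by simpa using hdn 0
  have he0 : (e : ℂ) ≠ 0 := by simpa using hen 0
  have hd1 : (d : ℂ) - 1 ≠ 0 := by exact_mod_cast (by linarith [h.2.1] : (0 : ℝ) < d - 1).ne'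
  have he1 : (e : ℂ) - 1 ≠ 0 := by exact_mod_cast (by linarith [h.2.2.1] : (0 : ℝ) < e - 1).ne'
  have hT' := h'.summable
  push_cast at hT'
  rw [tsum_of_telescoping (b := fun k => hypTerm k ((c : ℂ), (d : ℂ), (e : ℂ)) *
    (2 * α / ((d - 1) * (e - 1)) + α / ((d - 1) * (e - 1) * c) * k)) h.summable hT' ?_
    (h.tendsto_mul (norm_linear_le _ _))]
  · simp [hypTerm]
  · intro k
    have h1 := hdn k
    have h2 := hen k
    rw [hypTerm_add_one_fst k _ _ hc0, hypTerm_add_one_snd k _ _ hdn,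
      hypTerm_add_one_trd k _ _ hen, hypTerm_succ]
    push_cast
    field_simp
    rw [hd, he]
    push_cast
    ring

/-- The shift `α ↦ α + 1/2` sends `(d, e)` to `(e, d + 1)`, so symmetry in the lower parameters
makes the shifted series contiguous to the original one. -/
theorem duplication_contiguous {α d e : ℝ} (hd : d = α + 1) (he : e = α + 3 / 2)
    (h : GoodParameters (1 / 2) d e) (h' : GoodParameters (1 / 2) e (d + 1)) :
    2 / ((e : ℂ) - 1) * ∑' k, hypTerm k (((1 / 2 : ℝ) : ℂ), (d : ℂ), (e : ℂ)) +
      (-1 / d) * ∑' k, hypTerm k (((1 / 2 : ℝ) : ℂ), (e : ℂ), (d : ℂ) + 1) = 1 / (d - 1) := by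
  have hdn := ofReal_add_natCast_ne_zero (x := d) (by linarith [h.2.1])
  have hen := ofReal_add_natCast_ne_zero (x := e) (by linarith [h.2.2.1])
  have hd0 : (d : ℂ) ≠ 0 := by simpa using hdn 0
  have he0 : (e : ℂ) ≠ 0 := by simpa using hen 0
  have hd1 : (d : ℂ) - 1 ≠ 0 := by exact_mod_cast (by linarith [h.2.1] : (0 : ℝ) < d - 1).ne'
  have he1 : (e : ℂ) - 1 ≠ 0 := by exact_mod_cast (by linarith [h.2.2.1] : (0 : ℝ) < e - 1).ne'
  have hT' := h'.summable
  push_cast at hT'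
  rw [tsum_of_telescoping (b := fun k => hypTerm k (((1 / 2 : ℝ) : ℂ), (d : ℂ), (e : ℂ)) *
    (1 / (d - 1) + 1 / ((d - 1) * (e - 1)) * k)) h.summable (by push_cast; exact hT') ?_
    (h.tendsto_mul (norm_linear_le _ _))]
  · simp [hypTerm]
  · intro k
    have h1 := hdn k
    have h2 := hen k
    rw [hypTerm_swap k _ (e : ℂ), hypTerm_add_one_snd k _ _ hdn, hypTerm_succ]
    push_cast
    field_simp
    rw [hd, he]
    push_cast
    ring

theorem norm_div_ofReal_add_natCast_le {d C : ℝ} (hd : 1 ≤ d) (k n : ℕ) {x : ℂ}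
    (hx : ‖x‖ ≤ C * ((k : ℝ) + 1) ^ (n + 1)) : ‖x / (d + k)‖ ≤ C * ((k : ℝ) + 1) ^ n := by
  have hk : (0 : ℝ) ≤ k := k.cast_nonneg
  rw [norm_div, norm_ofReal_add_natCast (by linarith), div_le_iff₀ (by linarith)]
  refine hx.trans ?_
  have hC : 0 ≤ C * ((k : ℝ) + 1) ^ n := by
    have h : 0 ≤ C * ((k : ℝ) + 1) ^ n * (k + 1) := by
      rw [mul_assoc, ← pow_succ]
      exact (norm_nonneg x).trans hx
    exact nonneg_of_mul_nonneg_left h (by positivity)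
  rw [pow_succ, ← mul_assoc]
  exact mul_le_mul_of_nonneg_left (by linarith) hC

/-- The shift `α ↦ α + 1` sends `(c, d, e)` to `(c + 1, d + 2, e + 2)`. -/
theorem triplication_contiguous {α c d e : ℝ} (hc : c = α + 1) (hd : d = 2 * α + 4 / 3)
    (he : e = 2 * α + 5 / 3) (h : GoodParameters c d e)
    (h' : GoodParameters (c + 1) (d + 1 + 1) (e + 1 + 1)) :
    27 * α / (3 * (d - 1) * (e - 1)) * ∑' k, hypTerm k ((c : ℂ), (d : ℂ), (e : ℂ)) +
      (α + 1) / (3 * (d + 1) * (e + 1)) *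
        ∑' k, hypTerm k ((c : ℂ) + 1, (d : ℂ) + 1 + 1, (e : ℂ) + 1 + 1) =
    1 / (e - 1) + 1 / (3 * e) + 3 / (d - 1) + 1 / (3 * d) := by
  have hc0 : (c : ℂ) ≠ 0 := by exact_mod_cast h.1.ne'
  have hdn := ofReal_add_natCast_ne_zero (x := d) (by linarith [h.2.1])
  have hen := ofReal_add_natCast_ne_zero (x := e) (by linarith [h.2.2.1])
  have hdn' := ofReal_add_natCast_ne_zero (x := d + 1) (by linarith [h.2.1])
  have hen' := ofReal_add_natCast_ne_zero (x := e + 1) (by linarith [h.2.2.1])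
  have hd0 : (d : ℂ) ≠ 0 := by simpa using hdn 0
  have he0 : (e : ℂ) ≠ 0 := by simpa using hen 0
  have hd1 : (d : ℂ) - 1 ≠ 0 := by exact_mod_cast (by linarith [h.2.1] : (0 : ℝ) < d - 1).ne'
  have he1 : (e : ℂ) - 1 ≠ 0 := by exact_mod_cast (by linarith [h.2.2.1] : (0 : ℝ) < e - 1).ne'
  have hd2 : (d : ℂ) + 1 ≠ 0 := by exact_mod_cast (by linarith [h.2.1] : (0 : ℝ) < d + 1).ne'
  have he2 : (e : ℂ) + 1 ≠ 0 := by exact_mod_cast (by linarith [h.2.2.1] : (0 : ℝ) < e + 1).ne'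
  have hα : (c : ℂ) = α + 1 := by rw [hc]; push_cast; ring
  have hT' := h'.summable
  push_cast at hT' hdn' hen'
  set q : ℂ := 1 / (3 * (d - 1) * (e - 1)) with hq
  -- The certificate is a cubic in `k` over `(d + k)(e + k)`, hence of linear growth.
  have hb : Tendsto (fun k : ℕ => hypTerm k ((c : ℂ), (d : ℂ), (e : ℂ)) *
      (((q * (146 / 9 + 920 / 9 * α + 192 * α ^ 2 + 112 * α ^ 3) +
        (q * (371 / 9 + 156 * α + 136 * α ^ 2) + (q * (34 + 60 * α) + q * 9 * k) * k) * k) /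
          (d + k)) / (e + k))) atTop (𝓝 0) := by
    have h1 := fun k => norm_div_ofReal_add_natCast_le (d := d) (by linarith [h.2.1]) k 2
      (norm_cubic_le (q * (146 / 9 + 920 / 9 * α + 192 * α ^ 2 + 112 * α ^ 3))
        (q * (371 / 9 + 156 * α + 136 * α ^ 2)) (q * (34 + 60 * α)) (q * 9) k)
    have h2 := fun k => norm_div_ofReal_add_natCast_le (d := e) (by linarith [h.2.2.1]) k 1 (h1 k)
    simp only [pow_one] at h2
    exact h.tendsto_mul h2
  rw [tsum_of_telescoping h.summable hT' ?_ hb]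
  · simp only [hypTerm, Nat.factorial_zero, ascPochhammer_zero, Polynomial.eval_one, Nat.cast_zero,
      Nat.cast_one, mul_zero, add_zero, mul_one, div_one, one_mul, hq]
    field_simp
    rw [hd, he]
    push_cast
    ring
  · intro k
    have h1 := hdn k
    have h2 := hen k
    have h3 := hdn' k
    have h4 := hen' k
    have h5 : (d : ℂ) + (k + 1) ≠ 0 := by rwa [add_assoc, add_comm (1 : ℂ)] at h3
    have h6 : (e : ℂ) + (k + 1) ≠ 0 := by rwa [add_assoc, add_comm (1 : ℂ)] at h4
    rw [hypTerm_add_one_fst k _ _ hc0, hypTerm_add_one_snd k _ _ hdn',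
      hypTerm_add_one_snd k _ _ hdn, hypTerm_add_one_trd k _ _ hen',
      hypTerm_add_one_trd k _ _ hen, hypTerm_succ, ← hα, hq]
    push_cast
    rw [add_right_comm (d : ℂ) 1, add_assoc (d : ℂ) k 1,
      add_right_comm (e : ℂ) 1, add_assoc (e : ℂ) k 1]
    field_simp
    rw [hc, hd, he]
    push_cast
    ring

/-- The shift `α ↦ α + 1/2` sends `(c, d, e)` to `(c + 1, e + 1, d + 2)`, up to the order of the
lower parameters. The certificate is a quadratic in `k` over `d + k`. -/
theorem quadruplication_contiguous {α c d e : ℝ} (hc : c = 2 * α + 1) (hd : d = 3 * α + 5 / 4)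
    (he : e = 3 * α + 7 / 4) (h : GoodParameters c d e)
    (h' : GoodParameters (c + 1) (e + 1) (d + 1 + 1)) :
    8 * α / ((d - 1) * (e - 1)) * ∑' k, hypTerm k ((c : ℂ), (d : ℂ), (e : ℂ)) +
      (α + 1 / 2) / (e * (d + 1)) *
        ∑' k, hypTerm k ((c : ℂ) + 1, (e : ℂ) + 1, (d : ℂ) + 1 + 1) =
    2 / (d - 1) + 1 / (2 * (e - 1)) + 1 / (2 * d) := by
  have hc0 : (c : ℂ) ≠ 0 := by exact_mod_cast h.1.ne'
  have hdn := ofReal_add_natCast_ne_zero (x := d) (by linarith [h.2.1])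
  have hen := ofReal_add_natCast_ne_zero (x := e) (by linarith [h.2.2.1])
  have hdn' := ofReal_add_natCast_ne_zero (x := d + 1) (by linarith [h.2.1])
  have hd0 : (d : ℂ) ≠ 0 := by simpa using hdn 0
  have he0 : (e : ℂ) ≠ 0 := by simpa using hen 0
  have hd1 : (d : ℂ) - 1 ≠ 0 := by exact_mod_cast (by linarith [h.2.1] : (0 : ℝ) < d - 1).ne'
  have he1 : (e : ℂ) - 1 ≠ 0 := by exact_mod_cast (by linarith [h.2.2.1] : (0 : ℝ) < e - 1).ne'
  have hd2 : (d : ℂ) + 1 ≠ 0 := by exact_mod_cast (by linarith [h.2.1] : (0 : ℝ) < d + 1).ne'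
  have hα : (α : ℂ) + 1 / 2 = c / 2 := by rw [hc]; push_cast; ring
  have hT' := h'.summable
  push_cast at hT' hdn'
  set q : ℂ := 1 / ((d - 1) * (e - 1)) with hq
  have hb : Tendsto (fun k : ℕ => hypTerm k ((c : ℂ), (d : ℂ), (e : ℂ)) *
      ((q * (17 / 8 + 63 / 4 * α + 27 * α ^ 2) + (q * (33 / 8 + 27 / 2 * α) + q * 2 * k) * k) /
          (d + k))) atTop (𝓝 0) := by
    have h1 := fun k => norm_div_ofReal_add_natCast_le (d := d) (by linarith [h.2.1]) k 1
      (norm_quadratic_le (q * (17 / 8 + 63 / 4 * α + 27 * α ^ 2)) (q * (33 / 8 + 27 / 2 * α))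
        (q * 2) k)
    simp only [pow_one] at h1
    exact h.tendsto_mul h1
  rw [tsum_of_telescoping h.summable hT' ?_ hb]
  · simp only [hypTerm, Nat.factorial_zero, ascPochhammer_zero, Polynomial.eval_one, Nat.cast_zero,
      Nat.cast_one, mul_zero, add_zero, mul_one, div_one, one_mul, hq]
    field_simp
    rw [hd, he]
    push_cast
    ring
  · intro k
    have h1 := hdn k
    have h2 := hen k
    have h3 := hdn' k
    have h5 : (d : ℂ) + (k + 1) ≠ 0 := by rwa [add_assoc, add_comm (1 : ℂ)] at h3
    rw [hypTerm_swap k ((c : ℂ) + 1), hypTerm_add_one_fst k _ _ hc0, hypTerm_add_one_snd k _ _ hdn',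
      hypTerm_add_one_snd k _ _ hdn, hypTerm_add_one_trd k _ _ hen, hypTerm_succ, hα, hq]
    push_cast
    rw [add_right_comm (d : ℂ) 1, add_assoc (d : ℂ) k 1]
    field_simp
    rw [hc, hd, he]
    push_cast
    ring

/-! ### The four identities for large real parameters -/

/-- Iteration leaves the remainder `κ ^ N * L (x + δ N)`, which vanishes by the decay of `L` even
when `‖κ‖ = 1`. -/
theorem eq_of_hasSum_of_recurrence {L h : ℝ → ℂ} {κ s : ℂ} {δ A C x : ℝ} (hκ : ‖κ‖ ≤ 1)
    (hδ : 0 < δ) (hrec : ∀ x, A ≤ x → L x = h x + κ * L (x + δ))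
    (hL : ∀ x, A ≤ x → ‖L x‖ ≤ C / x) (hx : A ≤ x)
    (hs : HasSum (fun n : ℕ => κ ^ n * h (x + δ * n)) s) : L x = s := by
  have hN : ∀ N : ℕ, ∑ n ∈ Finset.range N, κ ^ n * h (x + δ * n) =
      L x - κ ^ N * L (x + δ * N) := by
    intro N
    induction N with
    | zero => simp
    | succ N ih =>
      have hAN : A ≤ x + δ * N := by
        have : 0 ≤ δ * N := by positivity
        linarith
      rw [Finset.sum_range_succ, ih, hrec _ hAN,
        show x + δ * N + δ = x + δ * ((N + 1 : ℕ) : ℝ) by push_cast; ring, pow_succ]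
      ring
  have htop : Tendsto (fun N : ℕ => x + δ * (N : ℝ)) atTop atTop :=
    tendsto_atTop_add_const_left _ _ (tendsto_natCast_atTop_atTop.const_mul_atTop hδ)
  have h0 : Tendsto (fun N : ℕ => κ ^ N * L (x + δ * N)) atTop (𝓝 0) := by
    refine squeeze_zero_norm (fun N => ?_) (htop.const_div_atTop C)
    rw [norm_mul, norm_pow]
    refine (mul_le_of_le_one_left (norm_nonneg _) (pow_le_one₀ (norm_nonneg _) hκ)).trans (hL _ ?_)
    have : 0 ≤ δ * N := by positivity
    linarith
  have h1 := (h0.const_sub (L x)).congr fun N => (hN N).symm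
  rw [sub_zero] at h1
  exact tendsto_nhds_unique h1 hs.tendsto_sum_nat

theorem GoodParameters.norm_mul_tsum_le {c d e p M x : ℝ} (h : GoodParameters c d e)
    (hp : |p| ≤ M / x) :
    ‖(p : ℂ) * ∑' k, hypTerm k ((c : ℂ), (d : ℂ), (e : ℂ))‖ ≤
      M * (∑' k : ℕ, 6 * (((k : ℝ) + 1) ^ 3)⁻¹) / x := by
  rw [norm_mul, Complex.norm_real, Real.norm_eq_abs, mul_div_right_comm]
  exact mul_le_mul hp h.norm_tsum_le (norm_nonneg _) ((abs_nonneg p).trans hp)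

theorem hasSum_lerchSum {κ : ℂ} {r : ℕ} {g : ℂ → ℂ} (h : LerchBound κ r g) (hr : 0 < r) (w : ℂ) :
    HasSum (fun n : ℕ => κ ^ n * g (w + r * n)) (lerchSum κ r g w) :=
  (h.summable hr w).hasSum

/-- The left hand side of the first identity. -/
noncomputable def alternatingValue (α β : ℂ) : ℂ :=
  α / ((β - α + 1) * (β + 1 + α)) * hyp3F2AtOne (β + 1) (β - α + 2) (β + 2 + α)

theorem alternatingValue_ofReal {α x c d e : ℝ} (hc : c = x + 1) (hd : d = x - α + 2)
    (he : e = x + 2 + α) (h : GoodParameters c d e) :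
    alternatingValue α x =
      (α : ℂ) / ((d - 1) * (e - 1)) * ∑' k, hypTerm k ((c : ℂ), (d : ℂ), (e : ℂ)) := by
  rw [← h.hyp3F2AtOne_eq, alternatingValue, hc, hd, he]
  push_cast
  rw [show (x : ℂ) - α + 2 - 1 = x - α + 1 by ring, show (x : ℂ) + 2 + α - 1 = x + 1 + α by ring]

/-- Here `c ≤ d` means `α ≤ 1` and `c ≤ e` means `α ≥ -1`; at least one always holds, whence the
alternative in `GoodParameters`. -/
theorem goodParameters_alternating {α x : ℝ} (hx : |α| + 3 ≤ x) :
    GoodParameters (x + 1) (x - α + 2) (x + 2 + α) := by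
  obtain ⟨h1, h2⟩ := abs_le.1 (by linarith : |α| ≤ x - 3)
  have h0 := abs_nonneg α
  refine ⟨by linarith, by linarith, by linarith, ?_⟩
  rcases le_total α 1 with h | h
  · exact Or.inl (by linarith)
  · exact Or.inr (by linarith)

theorem alternatingValue_eq_lerchSum_of_le {α x : ℝ} (hx : |α| + 3 ≤ x) :
    alternatingValue α x = lerchSum 1 2 (monomialMellin ![0, 1] ![1, -1]) (x - α) -
      lerchSum 1 2 (monomialMellin ![0, 1] ![1, -1]) (x + α) := by
  have hstep : ∀ x : ℝ, |α| + 3 ≤ x → alternatingValue α x + alternatingValue α (x + 1 : ℝ) =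
      1 / (x - α + 1) - 1 / (x + α + 1) := by
    intro x hx
    have h := goodParameters_alternating hx
    have h' : GoodParameters (x + 1 + 1) (x - α + 2 + 1) (x + 2 + α + 1) := by
      have := goodParameters_alternating (α := α) (x := x + 1) (by linarith)
      convert this using 1 <;> ring
    have hd1 : (x : ℂ) - α + 1 ≠ 0 := by
      exact_mod_cast (by linarith [h.2.1] : (0 : ℝ) < x - α + 1).ne'
    have he1 : (x : ℂ) + α + 1 ≠ 0 := by
      exact_mod_cast (by linarith [h.2.2.1] : (0 : ℝ) < x + α + 1).ne'
    have key := alternating_contiguous (α := α) (by ring) (by ring) h h'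
    rw [alternatingValue_ofReal rfl rfl rfl h,
      alternatingValue_ofReal (α := α) (x := x + 1) (by ring) (by ring) (by ring) h']
    push_cast at key ⊢
    simp only [add_sub_cancel_right]
    rw [key, show (x : ℂ) - α + 2 - 1 = x - α + 1 by ring,
      show (x : ℂ) + 2 + α - 1 = x + α + 1 by ring]
    field_simp
    ring
  have hs := (hasSum_lerchSum lerchBound_monomialMellin_alternating two_pos ((x : ℂ) - α)).sub
    (hasSum_lerchSum lerchBound_monomialMellin_alternating two_pos ((x : ℂ) + α))
  -- The one-step relation has `κ = -1`; applied twice it has `κ = 1` and `δ = 2`, as in the paired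
  -- series.
  refine eq_of_hasSum_of_recurrence (L := fun x : ℝ => alternatingValue α x)
    (h := fun x : ℝ => monomialMellin ![0, 1] ![1, -1] ((x : ℂ) - α) -
      monomialMellin ![0, 1] ![1, -1] ((x : ℂ) + α)) (κ := 1) (δ := 2) (A := |α| + 3)
      (C := |α| * ∑' k : ℕ, 6 * (((k : ℝ) + 1) ^ 3)⁻¹) (by simp) two_pos ?_ ?_ hx ?_
  · intro x hx
    have h1 := hstep x hx
    have h2 := hstep (x + 1) (by linarith)
    rw [show x + 1 + 1 = x + 2 by ring] at h2
    simp only [monomialMellin, Fin.sum_univ_two, Matrix.cons_val_zero, Matrix.cons_val_one,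
      Nat.cast_zero, Nat.cast_one, add_zero]
    push_cast at h1 h2 ⊢
    rw [show (x : ℂ) - α + 1 + 1 = x + 1 - α + 1 by ring,
      show (x : ℂ) + α + 1 + 1 = x + 1 + α + 1 by ring]
    linear_combination h1 - h2
  · intro x hx
    have h := goodParameters_alternating hx
    have hx0 : 0 < x := by linarith [abs_nonneg α]
    rw [alternatingValue_ofReal rfl rfl rfl h]
    have hp : |α / ((x - α + 2 - 1) * (x + 2 + α - 1))| ≤ |α| / x := by
      have h1 : x ≤ (x - α + 2 - 1) * (x + 2 + α - 1) := by
        have : α ^ 2 = |α| ^ 2 := (sq_abs α).symm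
        nlinarith [abs_nonneg α]
      rw [abs_div, abs_of_nonneg (hx0.le.trans h1)]
      exact div_le_div_of_nonneg_left (abs_nonneg α) hx0 h1
    have := h.norm_mul_tsum_le hp
    push_cast at this ⊢
    exact this
  · refine hs.congr_fun fun n => ?_
    push_cast
    rw [show (x : ℂ) + 2 * n - α = x - α + 2 * n by ring,
      show (x : ℂ) + 2 * n + α = x + α + 2 * n by ring]
    ring

/-- The left hand side of the second identity. -/
noncomputable def duplicationValue (α : ℂ) : ℂ :=
  1 / (α + 1 / 2) * hyp3F2AtOne (1 / 2) (α + 1) (α + 3 / 2)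

theorem duplicationValue_ofReal {x d e : ℝ} (hd : d = x + 1)
    (he : e = x + 3 / 2) (h : GoodParameters (1 / 2) d e) :
    duplicationValue x =
      1 / ((e : ℂ) - 1) * ∑' k, hypTerm k (((1 / 2 : ℝ) : ℂ), (d : ℂ), (e : ℂ)) := by
  rw [← h.hyp3F2AtOne_eq, duplicationValue, hd, he]
  push_cast
  rw [show (x : ℂ) + 3 / 2 - 1 = x + 1 / 2 by ring]

theorem duplicationValue_eq_lerchSum_of_le {x : ℝ} (hx : 3 ≤ x) :
    duplicationValue x =
      2 * lerchSum (1 / 2) 1 (monomialMellin ![0] ![1 / 2]) (2 * x - 1) := by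
  have good : ∀ x : ℝ, 3 ≤ x → GoodParameters (1 / 2) (x + 1) (x + 3 / 2) := fun x hx =>
    ⟨by norm_num, by linarith, by linarith, Or.inl (by linarith)⟩
  have hs := (hasSum_lerchSum (lerchBound_monomialMellin (m := ![0]) (c := ![1 / 2])
    (κ := 1 / 2) (by norm_num) 1) one_pos (2 * (x : ℂ) - 1)).mul_left 2
  -- The contiguous relation reads `2 V(x) - V(x + 1/2) = 1 / x`; the half step in `x` moves the
  -- exponent `2 x - 1` by one.
  refine eq_of_hasSum_of_recurrence (L := fun x : ℝ => duplicationValue x)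
    (h := fun x : ℝ => 2 * monomialMellin ![0] ![1 / 2] (2 * (x : ℂ) - 1))
      (κ := 1 / 2) (δ := 1 / 2) (A := 3)
      (C := 1 * ∑' k : ℕ, 6 * (((k : ℝ) + 1) ^ 3)⁻¹) (by norm_num) (by norm_num) ?_ ?_ hx ?_
  · intro x hx
    have h := good x hx
    have h' : GoodParameters (1 / 2) (x + 3 / 2) (x + 1 + 1) := by
      have := good (x + 1 / 2) (by linarith)
      convert this using 1 <;> ring
    have hx0 : (x : ℂ) ≠ 0 := by exact_mod_cast (by linarith : (0 : ℝ) < x).ne'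
    have key := duplication_contiguous (α := x) rfl rfl h h'
    simp only [monomialMellin, Finset.univ_unique, Fin.default_eq_zero, Finset.sum_singleton,
      Matrix.cons_val_fin_one, Nat.cast_zero, add_zero, sub_add_cancel]
    rw [duplicationValue_ofReal rfl rfl h,
      duplicationValue_ofReal (x := x + 1 / 2) (by ring) (by ring) h']
    push_cast at key ⊢
    simp only [add_sub_cancel_right] at key ⊢
    have : 2 * (1 / 2 / (2 * (x : ℂ))) = 1 / x / 2 := by
      field_simp
    rw [this]
    linear_combination key / 2
  · intro x hx
    have h := good x hx
    rw [duplicationValue_ofReal rfl rfl h]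
    have hp : |1 / (x + 3 / 2 - 1)| ≤ 1 / x := by
      rw [abs_of_nonneg (div_nonneg zero_le_one (by linarith))]
      exact div_le_div_of_nonneg_left zero_le_one (by linarith) (by linarith)
    have := h.norm_mul_tsum_le hp
    push_cast at this ⊢
    exact this
  · refine hs.congr_fun fun n => ?_
    push_cast
    rw [show 2 * ((x : ℂ) + 1 / 2 * n) - 1 = 2 * x - 1 + 1 * n by ring]
    ring

/-- The left hand side of the third identity. -/
noncomputable def triplicationValue (α : ℂ) : ℂ :=
  α / ((6 * α + 1) * (2 * α + 2 / 3)) *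
    hyp3F2AtOne (α + 1) (2 * α + 4 / 3) (2 * α + 5 / 3)

theorem triplicationValue_ofReal {x c d e : ℝ} (hc : c = x + 1) (hd : d = 2 * x + 4 / 3)
    (he : e = 2 * x + 5 / 3) (h : GoodParameters c d e) :
    triplicationValue x =
      x / (3 * (d - 1) * (e - 1)) * ∑' k, hypTerm k ((c : ℂ), (d : ℂ), (e : ℂ)) := by
  rw [← h.hyp3F2AtOne_eq, triplicationValue, hc, hd, he]
  push_cast
  rw [show 3 * (2 * (x : ℂ) + 4 / 3 - 1) = 6 * x + 1 by ring,
    show 2 * (x : ℂ) + 5 / 3 - 1 = 2 * x + 2 / 3 by ring]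

theorem triplicationValue_eq_lerchSum_of_le {x : ℝ} (hx : 3 ≤ x) :
    triplicationValue x =
      lerchSum (-1 / 27) 6 (monomialMellin ![0, 3] ![3 / 27, 1 / 27]) (6 * x + 1) +
      lerchSum (-1 / 27) 6 (monomialMellin ![0, 3] ![9 / 27, 1 / 27]) (6 * x) := by
  have good : ∀ x : ℝ, 3 ≤ x → GoodParameters (x + 1) (2 * x + 4 / 3) (2 * x + 5 / 3) :=
    fun x hx => ⟨by linarith, by linarith, by linarith, Or.inl (by linarith)⟩
  have hs := (hasSum_lerchSum (lerchBound_monomialMellin (m := ![0, 3]) (c := ![3 / 27, 1 / 27])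
    (κ := -1 / 27) (by norm_num) 6) (by norm_num) (6 * (x : ℂ) + 1)).add
    (hasSum_lerchSum (lerchBound_monomialMellin (m := ![0, 3]) (c := ![9 / 27, 1 / 27])
    (κ := -1 / 27) (by norm_num) 6) (by norm_num) (6 * (x : ℂ)))
  -- The contiguous relation has the form `27 V(x) + V(x + 1) = …`; the unit step moves the
  -- exponents by `6`.
  refine eq_of_hasSum_of_recurrence (L := fun x : ℝ => triplicationValue x)
    (h := fun x : ℝ => monomialMellin ![0, 3] ![3 / 27, 1 / 27] (6 * (x : ℂ) + 1) +
      monomialMellin ![0, 3] ![9 / 27, 1 / 27] (6 * (x : ℂ)))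
      (κ := -1 / 27) (δ := 1) (A := 3)
      (C := 1 * ∑' k : ℕ, 6 * (((k : ℝ) + 1) ^ 3)⁻¹) (by norm_num) (by norm_num) ?_ ?_ hx ?_
  · intro x hx
    have h := good x hx
    have h' : GoodParameters (x + 1 + 1) (2 * x + 4 / 3 + 1 + 1) (2 * x + 5 / 3 + 1 + 1) := by
      have := good (x + 1) (by linarith)
      convert this using 1 <;> ring
    have key := triplication_contiguous (α := x) rfl rfl rfl h h'
    have hne : ∀ t : ℝ, 0 ≤ t → 6 * (x : ℂ) + t ≠ 0 := by
      intro t ht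
      exact_mod_cast (by linarith : (0 : ℝ) < 6 * x + t).ne'
    have h1 := hne 1 (by norm_num)
    have h2 := hne 2 (by norm_num)
    have h4 := hne 4 (by norm_num)
    have h5 := hne 5 (by norm_num)
    simp only [monomialMellin, Fin.sum_univ_two, Matrix.cons_val_zero, Matrix.cons_val_one,
      Nat.cast_zero, Nat.cast_ofNat, add_zero]
    rw [triplicationValue_ofReal rfl rfl rfl h,
      triplicationValue_ofReal (x := x + 1) (by ring) (by ring) (by ring) h']
    push_cast at key h1 h2 h4 h5 ⊢
    simp only [add_sub_cancel_right]
    have e1 : 2 * (x : ℂ) + 4 / 3 - 1 = (6 * x + 1) / 3 := by ring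
    have e2 : 2 * (x : ℂ) + 5 / 3 - 1 = (6 * x + 2) / 3 := by ring
    have e4 : 2 * (x : ℂ) + 4 / 3 = (6 * x + 4) / 3 := by ring
    have e5 : 2 * (x : ℂ) + 5 / 3 = (6 * x + 5) / 3 := by ring
    have hh : 1 / (2 * (x : ℂ) + 5 / 3 - 1) + 1 / (3 * (2 * (x : ℂ) + 5 / 3)) +
        3 / (2 * (x : ℂ) + 4 / 3 - 1) + 1 / (3 * (2 * (x : ℂ) + 4 / 3)) =
        27 * (3 / 27 / (6 * (x : ℂ) + 1 + 1) + 1 / 27 / (6 * (x : ℂ) + 1 + 3 + 1) +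
        (9 / 27 / (6 * (x : ℂ) + 1) + 1 / 27 / (6 * (x : ℂ) + 3 + 1))) := by
      rw [e1, e2, e4, e5, show 6 * (x : ℂ) + 1 + 1 = 6 * x + 2 by ring,
        show 6 * (x : ℂ) + 1 + 3 + 1 = 6 * x + 5 by ring,
        show 6 * (x : ℂ) + 3 + 1 = 6 * x + 4 by ring]
      field_simp
      ring
    rw [hh] at key
    linear_combination key / 27
  · intro x hx
    have h := good x hx
    have hx0 : 0 < x := by linarith
    rw [triplicationValue_ofReal rfl rfl rfl h]
    have hp : |x / (3 * (2 * x + 4 / 3 - 1) * (2 * x + 5 / 3 - 1))| ≤ 1 / x := by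
      have hD : 0 < 3 * (2 * x + 4 / 3 - 1) * (2 * x + 5 / 3 - 1) :=
        mul_pos (by linarith) (by linarith)
      rw [abs_of_nonneg (div_nonneg hx0.le hD.le), div_le_div_iff₀ hD hx0]
      nlinarith
    have := h.norm_mul_tsum_le hp
    push_cast at this ⊢
    exact this
  · refine hs.congr_fun fun n => ?_
    push_cast
    rw [show 6 * ((x : ℂ) + 1 * n) + 1 = 6 * x + 1 + 6 * n by ring,
      show 6 * ((x : ℂ) + 1 * n) = 6 * x + 6 * n by ring]
    ring

/-- The left hand side of the fourth identity. -/
noncomputable def quadruplicationValue (α : ℂ) : ℂ :=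
  4 * α / ((12 * α + 1) * (3 * α + 3 / 4)) *
    hyp3F2AtOne (2 * α + 1) (3 * α + 5 / 4) (3 * α + 7 / 4)

theorem quadruplicationValue_ofReal {x c d e : ℝ} (hc : c = 2 * x + 1) (hd : d = 3 * x + 5 / 4)
    (he : e = 3 * x + 7 / 4) (h : GoodParameters c d e) :
    quadruplicationValue x =
      x / ((d - 1) * (e - 1)) * ∑' k, hypTerm k ((c : ℂ), (d : ℂ), (e : ℂ)) := by
  rw [← h.hyp3F2AtOne_eq, quadruplicationValue, hc, hd, he]
  push_cast
  rw [show 12 * (x : ℂ) + 1 = 4 * (3 * x + 5 / 4 - 1) by ring,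
    show 3 * (x : ℂ) + 7 / 4 - 1 = 3 * x + 3 / 4 by ring, mul_assoc,
    mul_div_mul_left _ _ (by norm_num : (4 : ℂ) ≠ 0)]

theorem quadruplicationValue_eq_lerchSum_of_le {x : ℝ} (hx : 3 ≤ x) :
    quadruplicationValue x =
      lerchSum (1 / 64) 12 (monomialMellin ![2, 6, 10] ![16 / 64, -8 / 64, -2 / 64]) (12 * x) +
      lerchSum (1 / 64) 12 (monomialMellin ![0, 4, 8] ![1, 16 / 64, -2 / 64]) (12 * x) := by
  have good : ∀ x : ℝ, 3 ≤ x → GoodParameters (2 * x + 1) (3 * x + 5 / 4) (3 * x + 7 / 4) :=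
    fun x hx => ⟨by linarith, by linarith, by linarith, Or.inl (by linarith)⟩
  have hstep : ∀ x : ℝ, 3 ≤ x →
      8 * quadruplicationValue x + quadruplicationValue (x + 1 / 2 : ℝ) =
        8 / (12 * x + 1) + 2 / (12 * x + 3) + 2 / (12 * x + 5) := by
    intro x hx
    have h := good x hx
    have h' : GoodParameters (2 * x + 1 + 1) (3 * x + 7 / 4 + 1) (3 * x + 5 / 4 + 1 + 1) := by
      have := good (x + 1 / 2) (by linarith)
      convert this using 1 <;> ring
    have key := quadruplication_contiguous (α := x) rfl rfl rfl h h'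
    have hne : ∀ t : ℝ, 0 ≤ t → 12 * (x : ℂ) + t ≠ 0 := by
      intro t ht
      exact_mod_cast (by linarith : (0 : ℝ) < 12 * x + t).ne'
    have h1 := hne 1 (by norm_num)
    have h3 := hne 3 (by norm_num)
    have h5 := hne 5 (by norm_num)
    rw [quadruplicationValue_ofReal rfl rfl rfl h,
      quadruplicationValue_ofReal (x := x + 1 / 2) (by ring) (by ring) (by ring) h']
    push_cast at key h1 h3 h5 ⊢
    simp only [add_sub_cancel_right]
    have hh : 2 / (3 * (x : ℂ) + 5 / 4 - 1) + 1 / (2 * (3 * (x : ℂ) + 7 / 4 - 1)) +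
        1 / (2 * (3 * (x : ℂ) + 5 / 4)) =
        8 / (12 * x + 1) + 2 / (12 * x + 3) + 2 / (12 * x + 5) := by
      rw [show 3 * (x : ℂ) + 5 / 4 - 1 = (12 * x + 1) / 4 by ring,
        show 3 * (x : ℂ) + 7 / 4 - 1 = (12 * x + 3) / 4 by ring,
        show 3 * (x : ℂ) + 5 / 4 = (12 * x + 5) / 4 by ring]
      field_simp
      ring
    rw [← hh, ← key]
    ring
  have hs := (hasSum_lerchSum (lerchBound_monomialMellin (m := ![2, 6, 10])
    (c := ![16 / 64, -8 / 64, -2 / 64]) (κ := 1 / 64) (by norm_num) 12) (by norm_num)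
    (12 * (x : ℂ))).add (hasSum_lerchSum (lerchBound_monomialMellin (m := ![0, 4, 8])
    (c := ![1, 16 / 64, -2 / 64]) (κ := 1 / 64) (by norm_num) 12) (by norm_num) (12 * (x : ℂ)))
  -- Two half steps with factor `-1/8` combine to `κ = 1/64` and `δ = 1`. The inhomogeneity at `x`
  -- supplies the monomials `0, 2, 4`, the one at `x + 1/2` the monomials `6, 8, 10`.
  refine eq_of_hasSum_of_recurrence (L := fun x : ℝ => quadruplicationValue x)
    (h := fun x : ℝ => monomialMellin ![2, 6, 10] ![16 / 64, -8 / 64, -2 / 64] (12 * (x : ℂ)) +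
      monomialMellin ![0, 4, 8] ![1, 16 / 64, -2 / 64] (12 * (x : ℂ)))
      (κ := 1 / 64) (δ := 1) (A := 3)
      (C := 1 * ∑' k : ℕ, 6 * (((k : ℝ) + 1) ^ 3)⁻¹) (by norm_num) (by norm_num) ?_ ?_ hx ?_
  · intro x hx
    have h1 := hstep x hx
    have h2 := hstep (x + 1 / 2) (by linarith)
    rw [show x + 1 / 2 + 1 / 2 = x + 1 by ring] at h2
    simp only [monomialMellin, Fin.sum_univ_three, Matrix.cons_val_zero, Matrix.cons_val_one,
      Matrix.cons_val, Nat.cast_zero, Nat.cast_ofNat, add_zero]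
    push_cast at h1 h2 ⊢
    rw [show 12 * ((x : ℂ) + 1 / 2) + 1 = 12 * x + 6 + 1 by ring,
      show 12 * ((x : ℂ) + 1 / 2) + 3 = 12 * x + 8 + 1 by ring,
      show 12 * ((x : ℂ) + 1 / 2) + 5 = 12 * x + 10 + 1 by ring] at h2
    rw [show 12 * (x : ℂ) + 3 = 12 * x + 2 + 1 by ring,
      show 12 * (x : ℂ) + 5 = 12 * x + 4 + 1 by ring] at h1
    linear_combination h1 / 8 - h2 / 64
  · intro x hx
    have h := good x hx
    have hx0 : 0 < x := by linarith
    rw [quadruplicationValue_ofReal rfl rfl rfl h]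
    have hp : |x / ((3 * x + 5 / 4 - 1) * (3 * x + 7 / 4 - 1))| ≤ 1 / x := by
      have hD : 0 < (3 * x + 5 / 4 - 1) * (3 * x + 7 / 4 - 1) :=
        mul_pos (by linarith) (by linarith)
      rw [abs_of_nonneg (div_nonneg hx0.le hD.le), div_le_div_iff₀ hD hx0]
      nlinarith
    have := h.norm_mul_tsum_le hp
    push_cast at this ⊢
    exact this
  · refine hs.congr_fun fun n => ?_
    push_cast
    rw [show 12 * ((x : ℂ) + 1 * n) = 12 * x + 12 * n by ring]
    ring

/-! ### The identity theorem on the complement of a countable set -/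

/-- The complement of a countable subset of the plane is path connected, and the two functions agree
on a real ray, which accumulates at one of its points in `U`. -/
theorem eqOn_of_eq_of_ofReal_ge {U : Set ℂ} (hU : IsOpen U) (hUc : Uᶜ.Countable) {F G : ℂ → ℂ}
    (hF : DifferentiableOn ℂ F U) (hG : DifferentiableOn ℂ G U) {A : ℝ}
    (h : ∀ x : ℝ, A ≤ x → F x = G x) : Set.EqOn F G U := by
  have hconn : IsPreconnected U := by
    have := (hUc.isPathConnected_compl_of_one_lt_rank
      (by rw [Complex.rank_real_complex]; exact Cardinal.one_lt_two)).isConnected.isPreconnected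
    rwa [compl_compl] at this
  -- Only countably many real points lie outside `U`, so some real point beyond `A` lies in it.
  obtain ⟨x₀, hx₀, hA⟩ : ∃ x : ℝ, (x : ℂ) ∈ U ∧ A < x := by
    have hd := (hUc.preimage Complex.ofReal_injective).dense_compl ℝ
    obtain ⟨x, hx, hxA⟩ := hd.exists_mem_open isOpen_Ioi (Set.nonempty_Ioi (a := A))
    exact ⟨x, by simpa using hx, hxA⟩
  refine (hF.analyticOnNhd hU).eqOn_of_preconnected_of_frequently_eq (hG.analyticOnNhd hU) hconn
    hx₀ ?_
  have hmap : Tendsto (fun x : ℝ => (x : ℂ)) (𝓝[>] x₀) (𝓝[≠] (x₀ : ℂ)) := by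
    refine tendsto_nhdsWithin_of_tendsto_nhds_of_eventually_within _
      (Complex.continuous_ofReal.continuousAt.tendsto.mono_left nhdsWithin_le_nhds) ?_
    filter_upwards [self_mem_nhdsWithin] with x hx h
    exact (ne_of_gt hx) (Complex.ofReal_injective h)
  refine hmap.frequently (Eventually.frequently ?_)
  filter_upwards [self_mem_nhdsWithin] with x hx using h x (hA.trans hx).le

/-- The points at which none of the affine functions `z ↦ aᵢ z + bᵢ` takes one of the values
`0, -1, -2, …`. -/
def affineDomain {ι : Type*} (a b : ι → ℂ) : Set ℂ :=
  {z | ∀ (i : ι) (n : ℕ), a i * z + b i ≠ -(n : ℂ)}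

section affineDomain

variable {ι : Type*} {a b : ι → ℂ}

theorem isOpen_affineDomain [Finite ι] : IsOpen (affineDomain a b) := by
  have : affineDomain a b =
      ⋂ i, (fun z => a i * z + b i) ⁻¹' {w : ℂ | ∀ n : ℕ, w ≠ -(n : ℂ)} := by
    ext z
    simp [affineDomain]
  rw [this]
  exact isOpen_iInter_of_finite fun i => isOpen_forall_ne_neg_natCast.preimage (by fun_prop)

theorem countable_compl_affineDomain [Finite ι] (ha : ∀ i, a i ≠ 0) : (affineDomain a b)ᶜ.Countable := by
  have : (affineDomain a b)ᶜ ⊆ ⋃ i, Set.range fun n : ℕ => (-(n : ℂ) - b i) / a i := by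
    intro z hz
    simp only [affineDomain, Set.mem_compl_iff, Set.mem_ofPred_eq, not_forall, not_not] at hz
    obtain ⟨i, n, h⟩ := hz
    refine Set.mem_iUnion.2 ⟨i, n, ?_⟩
    simp only
    rw [← h, add_sub_cancel_right, mul_div_cancel_left₀ _ (ha i)]
  exact (Set.countable_iUnion fun i => Set.countable_range _).mono this

theorem differentiableOn_affineDomain_of_differentiableAt {F : ℂ → ℂ}
    (hF : ∀ z ∈ affineDomain a b, DifferentiableAt ℂ F z) :
    DifferentiableOn ℂ F (affineDomain a b) :=
  fun z hz => (hF z hz).differentiableWithinAt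

end affineDomain

theorem differentiableAt_hyp3F2AtOne_comp {c d e : ℂ → ℂ} {z : ℂ}
    (hc : DifferentiableAt ℂ c z) (hd : DifferentiableAt ℂ d z) (he : DifferentiableAt ℂ e z)
    (h : (c z, d z, e z) ∈ hypDomain) :
    DifferentiableAt ℂ (fun z => hyp3F2AtOne (c z) (d z) (e z)) z := by
  have h1 := (isHypContinuation_hyp3F2AtOne.1 _ h).differentiableAt (isOpen_hypDomain.mem_nhds h)
  exact DifferentiableAt.comp z (f := fun z => (c z, d z, e z)) h1
    (hc.prodMk (hd.prodMk he))

theorem differentiableAt_lerchSum_monomialMellin_affine {ι : Type*} [Fintype ι] {m : ι → ℕ}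
    {c : ι → ℂ} {κ : ℂ} {r : ℕ} (hr : 0 < r) (hb : LerchBound κ r (monomialMellin m c))
    {w : ℂ → ℂ} {z : ℂ} (hw : DifferentiableAt ℂ w z)
    (h : ∀ (n : ℕ) (i : ι), w z + r * n + m i + 1 ≠ 0) :
    DifferentiableAt ℂ (fun z => lerchSum κ r (monomialMellin m c) (w z)) z :=
  DifferentiableAt.comp z (g := lerchSum κ r (monomialMellin m c)) (differentiableAt_lerchSum hb hr
    (fun _ hw => differentiableAt_monomialMellin_of_re_pos hw)
    (fun n => differentiableAt_monomialMellin (h n))) hw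

theorem differentiableAt_div {f g : ℂ → ℂ} {z : ℂ} (hf : DifferentiableAt ℂ f z)
    (hg : DifferentiableAt ℂ g z) (h : g z ≠ 0) : DifferentiableAt ℂ (fun z => f z / g z) z :=
  hf.div hg h

/-! ### Extension of the four identities to all admissible complex parameters. -/

/-- The continuation is in `β` with `α` fixed. The excess is `β + 1`; the other two conditions cover
the lower parameters, the prefactor and the poles of the two series. -/
theorem alternatingValue_eq_lerchSum {α : ℝ} {β : ℂ}
    (hβ : β ∈ affineDomain ![1, 1, 1] ![(1 : ℂ), 1 - α, 1 + α]) :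
    alternatingValue α β = lerchSum 1 2 (monomialMellin ![0, 1] ![1, -1]) (β - α) -
      lerchSum 1 2 (monomialMellin ![0, 1] ![1, -1]) (β + α) := by
  refine eqOn_of_eq_of_ofReal_ge (F := fun β => alternatingValue α β)
    (G := fun β => lerchSum 1 2 (monomialMellin ![0, 1] ![1, -1]) (β - α) -
      lerchSum 1 2 (monomialMellin ![0, 1] ![1, -1]) (β + α)) isOpen_affineDomain
    (countable_compl_affineDomain fun i => by fin_cases i <;> simp) (A := |α| + 3)
    (differentiableOn_affineDomain_of_differentiableAt fun z hz => ?_)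
    (differentiableOn_affineDomain_of_differentiableAt fun z hz => ?_)
    (fun x hx => alternatingValue_eq_lerchSum_of_le hx) hβ
  · have h0 := hz 0
    have h1 := hz 1
    have h2 := hz 2
    simp only [Matrix.cons_val_zero, Matrix.cons_val_one, Matrix.cons_val, one_mul] at h0 h1 h2
    refine DifferentiableAt.mul (differentiableAt_div (by fun_prop) (by fun_prop)
      (mul_ne_zero (fun h => h1 0 ?_) (fun h => h2 0 ?_)))
      (differentiableAt_hyp3F2AtOne_comp (by fun_prop) (by fun_prop) (by fun_prop) fun n =>
        ⟨fun h => h1 (n + 1) ?_, fun h => h2 (n + 1) ?_, fun h => h0 n ?_⟩) <;>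
      push_cast <;> linear_combination h
  · have h1 := hz 1
    have h2 := hz 2
    simp only [Matrix.cons_val_one, Matrix.cons_val, one_mul] at h1 h2
    refine DifferentiableAt.sub
      (differentiableAt_lerchSum_monomialMellin_affine two_pos lerchBound_monomialMellin_alternating
        (by fun_prop) fun n i h => h1 (2 * n + (![0, 1] : Fin 2 → ℕ) i) ?_)
      (differentiableAt_lerchSum_monomialMellin_affine two_pos lerchBound_monomialMellin_alternating
        (by fun_prop) fun n i h => h2 (2 * n + (![0, 1] : Fin 2 → ℕ) i) ?_) <;>
      push_cast at h ⊢ <;> linear_combination h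

/-- The excess is `2 α`. Zeros of the prefactor's denominator and bad lower parameters also have `2
α` among the negative integers, so one affine condition suffices. -/
theorem duplicationValue_eq_lerchSum {α : ℂ}
    (hα : α ∈ affineDomain (fun _ : Fin 1 => (2 : ℂ)) fun _ => 0) :
    duplicationValue α = 2 * lerchSum (1 / 2) 1 (monomialMellin ![0] ![1 / 2]) (2 * α - 1) := by
  refine eqOn_of_eq_of_ofReal_ge (F := duplicationValue)
    (G := fun α => 2 * lerchSum (1 / 2) 1 (monomialMellin ![0] ![1 / 2]) (2 * α - 1))
    isOpen_affineDomain (countable_compl_affineDomain fun i => by simp) (A := 3)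
    (differentiableOn_affineDomain_of_differentiableAt fun z hz => ?_)
    (differentiableOn_affineDomain_of_differentiableAt fun z hz => ?_)
    (fun x hx => duplicationValue_eq_lerchSum_of_le hx) hα
  · have h0 := hz 0
    simp only [add_zero] at h0
    refine DifferentiableAt.mul (differentiableAt_div (by fun_prop) (by fun_prop)
      (fun h => h0 1 ?_))
      (differentiableAt_hyp3F2AtOne_comp (by fun_prop) (by fun_prop) (by fun_prop) fun n =>
        ⟨fun h => h0 (2 * n + 2) ?_, fun h => h0 (2 * n + 3) ?_, fun h => h0 n ?_⟩) <;>
      push_cast <;> first | linear_combination 2 * h | linear_combination h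
  · have h0 := hz 0
    simp only [add_zero] at h0
    refine DifferentiableAt.const_mul (differentiableAt_lerchSum_monomialMellin_affine one_pos
      (lerchBound_monomialMellin (by norm_num) 1) (by fun_prop)
      fun n i h => h0 (n + (![0] : Fin 1 → ℕ) i) ?_) 2
    push_cast at h ⊢
    linear_combination h

/-- The excess is `3 α`, and the two series have their possible poles where `2 α + 2/3` or `2 α +
1/3` is in `{0, -1, -2, …}`. -/
theorem triplicationValue_eq_lerchSum {α : ℂ}
    (hα : α ∈ affineDomain ![(3 : ℂ), 2, 2] ![0, 1 / 3, 2 / 3]) :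
    triplicationValue α =
      lerchSum (-1 / 27) 6 (monomialMellin ![0, 3] ![3 / 27, 1 / 27]) (6 * α + 1) +
      lerchSum (-1 / 27) 6 (monomialMellin ![0, 3] ![9 / 27, 1 / 27]) (6 * α) := by
  refine eqOn_of_eq_of_ofReal_ge (F := triplicationValue) (G := fun α =>
      lerchSum (-1 / 27) 6 (monomialMellin ![0, 3] ![3 / 27, 1 / 27]) (6 * α + 1) +
      lerchSum (-1 / 27) 6 (monomialMellin ![0, 3] ![9 / 27, 1 / 27]) (6 * α))
    isOpen_affineDomain (countable_compl_affineDomain fun i => by fin_cases i <;> simp) (A := 3)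
    (differentiableOn_affineDomain_of_differentiableAt fun z hz => ?_)
    (differentiableOn_affineDomain_of_differentiableAt fun z hz => ?_)
    (fun x hx => triplicationValue_eq_lerchSum_of_le hx) hα
  · have h0 := hz 0
    have h1 := hz 1
    have h2 := hz 2
    simp only [Matrix.cons_val_zero, Matrix.cons_val_one, Matrix.cons_val, add_zero] at h0 h1 h2
    refine DifferentiableAt.mul (differentiableAt_div (by fun_prop) (by fun_prop)
      (mul_ne_zero (fun h => h1 0 ?_) (fun h => h2 0 ?_)))
      (differentiableAt_hyp3F2AtOne_comp (by fun_prop) (by fun_prop) (by fun_prop) fun n =>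
        ⟨fun h => h1 (n + 1) ?_, fun h => h2 (n + 1) ?_, fun h => h0 n ?_⟩) <;>
      push_cast <;> first | linear_combination h | linear_combination h / 3
  · have h1 := hz 1
    have h2 := hz 2
    simp only [Matrix.cons_val_one, Matrix.cons_val] at h1 h2
    refine DifferentiableAt.add
      (differentiableAt_lerchSum_monomialMellin_affine (by norm_num)
        (lerchBound_monomialMellin (by norm_num) 6) (by fun_prop)
        fun n i h => h2 (2 * n + (![0, 1] : Fin 2 → ℕ) i) ?_)
      (differentiableAt_lerchSum_monomialMellin_affine (by norm_num)
        (lerchBound_monomialMellin (by norm_num) 6) (by fun_prop)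
        fun n i h => h1 (2 * n + (![0, 1] : Fin 2 → ℕ) i) ?_) <;>
      fin_cases i <;> simp at h ⊢ <;> linear_combination h / 3

/-- The excess is `4 α`. Each series combines three residues modulo `12` that form one progression
of step `4`, so its possible poles are governed by `3 α + 3/4` or by `3 α + 1/4`. -/
theorem quadruplicationValue_eq_lerchSum {α : ℂ}
    (hα : α ∈ affineDomain ![(4 : ℂ), 3, 3] ![0, 1 / 4, 3 / 4]) :
    quadruplicationValue α =
      lerchSum (1 / 64) 12 (monomialMellin ![2, 6, 10] ![16 / 64, -8 / 64, -2 / 64]) (12 * α) +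
      lerchSum (1 / 64) 12 (monomialMellin ![0, 4, 8] ![1, 16 / 64, -2 / 64]) (12 * α) := by
  refine eqOn_of_eq_of_ofReal_ge (F := quadruplicationValue) (G := fun α =>
      lerchSum (1 / 64) 12 (monomialMellin ![2, 6, 10] ![16 / 64, -8 / 64, -2 / 64]) (12 * α) +
      lerchSum (1 / 64) 12 (monomialMellin ![0, 4, 8] ![1, 16 / 64, -2 / 64]) (12 * α))
    isOpen_affineDomain (countable_compl_affineDomain fun i => by fin_cases i <;> simp) (A := 3)
    (differentiableOn_affineDomain_of_differentiableAt fun z hz => ?_)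
    (differentiableOn_affineDomain_of_differentiableAt fun z hz => ?_)
    (fun x hx => quadruplicationValue_eq_lerchSum_of_le hx) hα
  · have h0 := hz 0
    have h1 := hz 1
    have h2 := hz 2
    simp only [Matrix.cons_val_zero, Matrix.cons_val_one, Matrix.cons_val, add_zero] at h0 h1 h2
    refine DifferentiableAt.mul (differentiableAt_div (by fun_prop) (by fun_prop)
      (mul_ne_zero (fun h => h1 0 ?_) (fun h => h2 0 ?_)))
      (differentiableAt_hyp3F2AtOne_comp (by fun_prop) (by fun_prop) (by fun_prop) fun n =>
        ⟨fun h => h1 (n + 1) ?_, fun h => h2 (n + 1) ?_, fun h => h0 n ?_⟩) <;>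
      push_cast <;> first | linear_combination h | linear_combination h / 4
  · have h1 := hz 1
    have h2 := hz 2
    simp only [Matrix.cons_val_one, Matrix.cons_val] at h1 h2
    refine DifferentiableAt.add
      (differentiableAt_lerchSum_monomialMellin_affine (by norm_num)
        (lerchBound_monomialMellin (by norm_num) 12) (by fun_prop)
        fun n i h => h2 (3 * n + (![0, 1, 2] : Fin 3 → ℕ) i) ?_)
      (differentiableAt_lerchSum_monomialMellin_affine (by norm_num)
        (lerchBound_monomialMellin (by norm_num) 12) (by fun_prop)
        fun n i h => h1 (3 * n + (![0, 1, 2] : Fin 3 → ℕ) i) ?_) <;>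
      fin_cases i <;> simp at h ⊢ <;> linear_combination h / 4

/-! ### The Pochhammer integrals of the four families -/

theorem ofReal_ne_neg_natCast {x : ℝ} (h : ∀ n : ℕ, x ≠ -(n : ℝ)) (n : ℕ) :
    (x : ℂ) ≠ -(n : ℂ) := by
  exact_mod_cast h n

theorem const_add_ne_zero_of_mem_puncturedUnitDisc {z : ℂ} (hz : z ∈ puncturedUnitDisc) {A : ℝ}
    (hA : 1 < A) {κ : ℂ} (hκ : ‖κ‖ ≤ 1) (n : ℕ) : (A : ℂ) + κ * z ^ n ≠ 0 := by
  intro h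
  have h1 : ‖κ * z ^ n‖ ≤ 1 := by
    rw [norm_mul, norm_pow]
    exact mul_le_one₀ hκ (by positivity) (pow_le_one₀ (norm_nonneg _) hz.1)
  have h2 : (A : ℂ) = -(κ * z ^ n) := eq_neg_of_add_eq_zero_left h
  rw [← norm_neg, ← h2, Complex.norm_real, Real.norm_of_nonneg (by linarith)] at h1
  linarith

theorem two_sub_ne_zero {z : ℂ} (hz : z ∈ puncturedUnitDisc) : 2 - z ≠ 0 := by
  have h := const_add_ne_zero_of_mem_puncturedUnitDisc hz one_lt_two (κ := -1) (by simp) 1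
  push_cast at h
  rwa [pow_one, neg_one_mul, ← sub_eq_add_neg] at h

theorem twentySeven_add_pow_ne_zero {z : ℂ} (hz : z ∈ puncturedUnitDisc) : 27 + z ^ 6 ≠ 0 := by
  have h := const_add_ne_zero_of_mem_puncturedUnitDisc hz (A := 27) (by norm_num) (κ := 1)
    (by simp) 6
  push_cast at h
  rwa [one_mul] at h

theorem sixtyFour_sub_pow_ne_zero {z : ℂ} (hz : z ∈ puncturedUnitDisc) : 64 - z ^ 12 ≠ 0 := by
  have h := const_add_ne_zero_of_mem_puncturedUnitDisc hz (A := 64) (by norm_num) (κ := -1)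
    (by simp) 12
  push_cast at h
  rwa [neg_one_mul, ← sub_eq_add_neg] at h

theorem one_add_ne_zero {z : ℂ} (hz : z ∈ puncturedUnitDisc) : 1 + z ≠ 0 :=
  fun h => hz.2 (eq_neg_of_add_eq_zero_right h)

section

variable {ε a : ℝ}

/-- The functional equation is `1 / (1 + x) = 1 - x + x² / (1 + x)`, in the paired form that yields
absolute convergence. -/
theorem pochhammerIntegral_one_div_one_add (hε : 0 < ε) (hε1 : ε < 1)
    (ha : ∀ n : ℕ, (a : ℂ) + n + 1 ≠ 0) :
    pochhammerIntegral ε a (fun x => 1 / (1 + x)) =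
      lerchSum 1 2 (monomialMellin ![0, 1] ![1, -1]) a := by
  refine pochhammerIntegral_eq_lerchSum hε hε1
    (continuousOn_const.div (by fun_prop) fun z hz => one_add_ne_zero hz) (fun z hz => ?_)
    (by simp) two_pos lerchBound_monomialMellin_alternating fun n i h => ?_
  · have := one_add_ne_zero hz
    simp only [Fin.sum_univ_two, Matrix.cons_val_zero, Matrix.cons_val_one]
    field_simp
    ring
  · refine ha (2 * n + (![0, 1] : Fin 2 → ℕ) i) ?_
    push_cast at h ⊢
    linear_combination h

theorem pochhammerIntegral_one_div_two_sub (hε : 0 < ε) (hε1 : ε < 1)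
    (ha : ∀ n : ℕ, (a : ℂ) + n + 1 ≠ 0) :
    pochhammerIntegral ε a (fun x => 1 / (2 - x)) =
      lerchSum (1 / 2) 1 (monomialMellin ![0] ![1 / 2]) a := by
  refine pochhammerIntegral_eq_lerchSum hε hε1
    (continuousOn_const.div (by fun_prop) fun z hz => two_sub_ne_zero hz) (fun z hz => ?_)
    (by norm_num) one_pos (lerchBound_monomialMellin (by norm_num) 1) fun n i h => ?_
  · have := two_sub_ne_zero hz
    simp only [Finset.univ_unique, Fin.default_eq_zero, Finset.sum_singleton,
      Matrix.cons_val_fin_one]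
    field_simp
    ring
  · refine ha (n + (![0] : Fin 1 → ℕ) i) ?_
    push_cast at h ⊢
    linear_combination h

/-- Multiplying out `(27 + x⁶) f = c + x³` gives `κ = -1/27`. The exponents `0, 3` modulo `6` form a
progression of step `3`. -/
theorem pochhammerIntegral_cubic (c : ℂ) (hε : 0 < ε) (hε1 : ε < 1)
    (ha : ∀ n : ℕ, (a : ℂ) + 3 * n + 1 ≠ 0) :
    pochhammerIntegral ε a (fun x => (c + x ^ 3) / (27 + x ^ 6)) =
      lerchSum (-1 / 27) 6 (monomialMellin ![0, 3] ![c / 27, 1 / 27]) a := by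
  refine pochhammerIntegral_eq_lerchSum hε hε1
    (ContinuousOn.div (by fun_prop) (by fun_prop) fun z hz => twentySeven_add_pow_ne_zero hz)
    (fun z hz => ?_) (by norm_num) (by norm_num) (lerchBound_monomialMellin (by norm_num) 6)
    fun n i h => ?_
  · have := twentySeven_add_pow_ne_zero hz
    simp only [Fin.sum_univ_two, Matrix.cons_val_zero, Matrix.cons_val_one]
    field_simp
    ring
  · refine ha (2 * n + (![0, 1] : Fin 2 → ℕ) i) ?_
    fin_cases i <;> simp at h ⊢ <;> linear_combination h

theorem pochhammerIntegral_quartic_left (hε : 0 < ε) (hε1 : ε < 1)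
    (ha : ∀ n : ℕ, (a : ℂ) + 4 * n + 3 ≠ 0) :
    pochhammerIntegral ε a (fun y => 2 * y ^ 2 * (8 - 4 * y ^ 4 - y ^ 8) / (64 - y ^ 12)) =
      lerchSum (1 / 64) 12 (monomialMellin ![2, 6, 10] ![16 / 64, -8 / 64, -2 / 64]) a := by
  refine pochhammerIntegral_eq_lerchSum hε hε1
    (ContinuousOn.div (by fun_prop) (by fun_prop) fun z hz => sixtyFour_sub_pow_ne_zero hz)
    (fun z hz => ?_) (by norm_num) (by norm_num) (lerchBound_monomialMellin (by norm_num) 12)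
    fun n i h => ?_
  · have := sixtyFour_sub_pow_ne_zero hz
    simp only [Fin.sum_univ_three, Matrix.cons_val_zero, Matrix.cons_val_one, Matrix.cons_val]
    field_simp
    ring
  · refine ha (3 * n + (![0, 1, 2] : Fin 3 → ℕ) i) ?_
    fin_cases i <;> simp at h ⊢ <;> linear_combination h

theorem pochhammerIntegral_quartic_right (hε : 0 < ε) (hε1 : ε < 1)
    (ha : ∀ n : ℕ, (a : ℂ) + 4 * n + 1 ≠ 0) :
    pochhammerIntegral ε a (fun x => 2 * (8 * x ^ 4 + 32 - x ^ 8) / (64 - x ^ 12)) =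
      lerchSum (1 / 64) 12 (monomialMellin ![0, 4, 8] ![1, 16 / 64, -2 / 64]) a := by
  refine pochhammerIntegral_eq_lerchSum hε hε1
    (ContinuousOn.div (by fun_prop) (by fun_prop) fun z hz => sixtyFour_sub_pow_ne_zero hz)
    (fun z hz => ?_) (by norm_num) (by norm_num) (lerchBound_monomialMellin (by norm_num) 12)
    fun n i h => ?_
  · have := sixtyFour_sub_pow_ne_zero hz
    simp only [Fin.sum_univ_three, Matrix.cons_val_zero, Matrix.cons_val_one, Matrix.cons_val]
    field_simp
    ring
  · refine ha (3 * n + (![0, 1, 2] : Fin 3 → ℕ) i) ?_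
    fin_cases i <;> simp at h ⊢ <;> linear_combination h

end

/-! ### The four identities: matching the two evaluations. -/

theorem mainTheorem1 :
    -- the radius of the small circle in the Pochhammer integrals
    ∀ ε : ℝ, 0 < ε → ε < 1 →
    -- first family
    (∀ α β : ℝ, (∀ n : ℤ, α ≠ n) → (∀ n : ℕ, β ≠ -((n : ℝ) + 1)) →
      (∀ n : ℕ, β - α ≠ -((n : ℝ) + 1)) → (∀ n : ℕ, β + α ≠ -((n : ℝ) + 1)) →
      (α : ℂ) / (((β : ℂ) - α + 1) * ((β : ℂ) + 1 + α)) *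
          hyp3F2AtOne ((β : ℂ) + 1) ((β : ℂ) - α + 2) ((β : ℂ) + 2 + α) =
        pochhammerIntegral ε (β - α) (fun x => 1 / (1 + x)) -
          pochhammerIntegral ε (β + α) (fun x => 1 / (1 + x))) ∧
    -- second family
    (∀ α : ℝ, (∀ n : ℤ, 2 * α ≠ n) →
      1 / ((α : ℂ) + 1 / 2) * hyp3F2AtOne (1 / 2) ((α : ℂ) + 1) ((α : ℂ) + 3 / 2) =
        2 * pochhammerIntegral ε (2 * α - 1) (fun x => 1 / (2 - x))) ∧
    -- third family
    (∀ α : ℝ, (∀ n : ℤ, 3 * α ≠ n) →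
      (∀ n : ℕ, 2 * α + 1 / 3 ≠ -(n : ℝ)) → (∀ n : ℕ, 2 * α + 2 / 3 ≠ -(n : ℝ)) →
      (α : ℂ) / ((6 * (α : ℂ) + 1) * (2 * (α : ℂ) + 2 / 3)) *
          hyp3F2AtOne ((α : ℂ) + 1) (2 * (α : ℂ) + 4 / 3) (2 * (α : ℂ) + 5 / 3) =
        pochhammerIntegral ε (6 * α + 1) (fun y => (3 + y ^ 3) / (27 + y ^ 6)) +
          pochhammerIntegral ε (6 * α) (fun x => (9 + x ^ 3) / (27 + x ^ 6))) ∧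
    -- fourth family
    (∀ α : ℝ, (∀ n : ℤ, 4 * α ≠ n) →
      (∀ n : ℕ, 3 * α + 1 / 4 ≠ -(n : ℝ)) → (∀ n : ℕ, 3 * α + 3 / 4 ≠ -(n : ℝ)) →
      4 * (α : ℂ) / ((12 * (α : ℂ) + 1) * (3 * (α : ℂ) + 3 / 4)) *
          hyp3F2AtOne (2 * (α : ℂ) + 1) (3 * (α : ℂ) + 5 / 4) (3 * (α : ℂ) + 7 / 4) =
        pochhammerIntegral ε (12 * α)
            (fun y => 2 * y ^ 2 * (8 - 4 * y ^ 4 - y ^ 8) / (64 - y ^ 12)) +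
          pochhammerIntegral ε (12 * α)
            (fun x => 2 * (8 * x ^ 4 + 32 - x ^ 8) / (64 - x ^ 12))) := by
  intro ε hε hε1
  refine ⟨fun α β _ h0 h1 h2 => ?_, fun α h0 => ?_, fun α h0 h1 h2 => ?_, fun α h0 h1 h2 => ?_⟩
  · have hβ : (β : ℂ) ∈ affineDomain ![1, 1, 1] ![(1 : ℂ), 1 - α, 1 + α] := by
      intro i n
      have h0' : (β : ℂ) ≠ -((n : ℂ) + 1) := by exact_mod_cast h0 n
      have h1' : (β : ℂ) - α ≠ -((n : ℂ) + 1) := by exact_mod_cast h1 n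
      have h2' : (β : ℂ) + α ≠ -((n : ℂ) + 1) := by exact_mod_cast h2 n
      fin_cases i <;> simp <;> intro h
      · exact h0' (by linear_combination h)
      · exact h1' (by linear_combination h)
      · exact h2' (by linear_combination h)
    have key := alternatingValue_eq_lerchSum hβ
    rw [alternatingValue] at key
    rw [key, pochhammerIntegral_one_div_one_add hε hε1 fun n h => h1 n ?_,
      pochhammerIntegral_one_div_one_add hε hε1 fun n h => h2 n ?_]
    · push_cast
      rfl
    · have h' : β + α + n + 1 = 0 := by exact_mod_cast h
      linarith
    · have h' : β - α + n + 1 = 0 := by exact_mod_cast h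
      linarith
  · have h2α : ∀ n : ℕ, 2 * (α : ℂ) ≠ -(n : ℂ) := fun n => by
      have := h0 (-(n : ℤ))
      exact_mod_cast this
    have key := duplicationValue_eq_lerchSum (α := α) fun _ n => by simpa using h2α n
    rw [duplicationValue] at key
    rw [key, pochhammerIntegral_one_div_two_sub hε hε1 fun n h => h2α n ?_]
    · push_cast
      rfl
    · push_cast at h
      linear_combination h
  · have h1' : ∀ n : ℕ, 2 * (α : ℂ) + 1 / 3 ≠ -(n : ℂ) := fun n => by
      have := ofReal_ne_neg_natCast h1 n
      push_cast at this
      exact this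
    have h2' : ∀ n : ℕ, 2 * (α : ℂ) + 2 / 3 ≠ -(n : ℂ) := fun n => by
      have := ofReal_ne_neg_natCast h2 n
      push_cast at this
      exact this
    have hα : (α : ℂ) ∈ affineDomain ![(3 : ℂ), 2, 2] ![0, 1 / 3, 2 / 3] := by
      intro i n
      have h0' : 3 * (α : ℂ) ≠ -(n : ℂ) := by
        have := h0 (-(n : ℤ))
        exact_mod_cast this
      fin_cases i
      · simpa using h0'
      · simpa using h1' n
      · simpa using h2' n
    have key := triplicationValue_eq_lerchSum hα
    rw [triplicationValue] at key
    rw [key, pochhammerIntegral_cubic 3 hε hε1 fun n h => h2' n ?_,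
      pochhammerIntegral_cubic 9 hε hε1 fun n h => h1' n ?_]
    · push_cast
      rfl
    · push_cast at h
      linear_combination h / 3
    · push_cast at h
      linear_combination h / 3
  · have h1' : ∀ n : ℕ, 3 * (α : ℂ) + 1 / 4 ≠ -(n : ℂ) := fun n => by
      have := ofReal_ne_neg_natCast h1 n
      push_cast at this
      exact this
    have h2' : ∀ n : ℕ, 3 * (α : ℂ) + 3 / 4 ≠ -(n : ℂ) := fun n => by
      have := ofReal_ne_neg_natCast h2 n
      push_cast at this
      exact this
    have hα : (α : ℂ) ∈ affineDomain ![(4 : ℂ), 3, 3] ![0, 1 / 4, 3 / 4] := by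
      intro i n
      have h0' : 4 * (α : ℂ) ≠ -(n : ℂ) := by
        have := h0 (-(n : ℤ))
        exact_mod_cast this
      fin_cases i
      · simpa using h0'
      · simpa using h1' n
      · simpa using h2' n
    have key := quadruplicationValue_eq_lerchSum hα
    rw [quadruplicationValue] at key
    rw [key, pochhammerIntegral_quartic_left hε hε1 fun n h => h2' n ?_,
      pochhammerIntegral_quartic_right hε hε1 fun n h => h1' n ?_]
    · push_cast
      rfl
    · push_cast at h
      linear_combination h / 4
    · push_cast at h
      linear_combination h / 4
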